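/- **Model.** Fix $H_{\mathrm b},H_{\mathrm u}>0$ (altitudes), $P_{\mathrm b},P_{\mathrm u}>0$ (transmit powers), $G_{\mathrm M,\mathrm b},G_{\mathrm M,\mathrm u}>0$ (maximal antenna gains), $\vartheta_{\mathrm b},\vartheta_{\mathrm u}>0$ (beamwidths), $\mu_{\mathrm{SLA}}>0$, $\mu_a,\mu_b>0$, noise power $N_0\ge 0$, and, for $k\in\mathcal K=\{\mathrm b,\mathrm L,\mathrm N\}$, path-loss intercepts $\kappa_k>0$, path-loss exponents $\alpha_k>0$ and fading parameters $\mathsf M_k>0$ with $\mathsf M_{\mathrm b}=1$. Let $G_j(\theta)=G_{\mathrm M,j}\,10^{-\min\{12(\theta/\vartheta_j)^2,\ \mu_{\mathrm{SLA}}\}}$ for $j\in\{\mathrm b,\mathrm u\}$. Terrestrial base stations (TBSs, altitude $H_{\mathrm b}$) and UAVs (altitude $H_{\mathrm u}$) are above the points of two independent homogeneous Poisson point processes in the plane, with densities $\lambda_{\mathrm b}>0$ and $\lambda_{\mathrm u}>0$; the typical user is at the origin $O$ of the ground. Independently of all else, a UAV at distance $r$ from $O$ is in line of sight (tier $\mathrm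 L$) with probability $$p_{\mathrm L}(r)=\frac1{1+\mu_a\exp\{-\mu_b[\frac{180}{\pi}\arcsin(H_{\mathrm u}/r)-\mu_a]\}},$$ and otherwise belongs to tier $\mathrm N$; the TBSs form tier $\mathrm b$. In the scenario $\varsigma=\mathrm{SA}$ each UAV points its beam at the user that it serves, in the scenario $\varsigma=\mathrm{VA}$ vertically downwards. The average power received from a serving transmitter of tier $k$ at distance $r$ is $$l^{(\varsigma)}_{\mathrm b}(r)=P_{\mathrm b}G_{\mathrm b}(\arccos(H_{\mathrm b}/r))\kappa_{\mathrm b}r^{-\alpha_{\mathrm b}},\quad l_k^{(\mathrm{VA})}(r)=P_{\mathrm u}G_{\mathrm u}(\arccos(H_{\mathrm u}/r))\kappa_kr^{-\alpha_k},\quad l_k^{(\mathrm{SA})}(r)=P_{\mathrm u}G_{\mathrm u}(0)\kappa_kr^{-\alpha_k}\quad(k\in\{\mathrm L,\mathrm N\}).$$ The typical user is associated with the transmitter $X^\star$ of the largest average received power, and $A^{(\varsigma)}_k$ is the probability that $X^\star$ belongs to tier $k$. Let $\chi^{(\varsigma)}_{\mathrm L,\mathrm b}(r)$ be the distance $x\ge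 H_{\mathrm b}$ with $l^{(\varsigma)}_{\mathrm b}(x)=l^{(\varsigma)}_{\mathrm L}(r)$ if it exists, and $H_{\mathrm b}$ if $l_{\mathrm L}^{(\varsigma)}(r)>l_{\mathrm b}^{(\varsigma)}(H_{\mathrm b})$. All fading gains $\mathsf H_X$ are independent, Gamma distributed with shape $\mathsf M_k$ and mean $1$ for $X$ in tier $k$. The signal-to-interference-plus-noise ratio is $$\mathrm{SINR}=\frac{l_k^{(\varsigma)}(\|X^\star\|)\,\mathsf H_{X^\star}}{N_0+\sum_{X\ne X^\star}P_XG_X\mathsf H_X\kappa_X\|X\|^{-\alpha_X}},$$ where $k$ is the tier of $X^\star$, $\|X\|$ is the distance from $X$ to $O$, and $P_X,\kappa_X,\alpha_X$ are the parameters of the tier of $X$. For a TBS $G_X=G_{\mathrm b}(\arccos(H_{\mathrm b}/\|X\|))$; for a UAV $G_X=G_{\mathrm u}(\Theta_X)$ with $\Theta_X$ the angle at $X$ between the directions to $O$ and to its beam target. For $\varsigma=\mathrm{VA}$ the beam target is the ground point below $X$; for $\varsigma=\mathrm{SA}$ it is a ground point in a uniformly distributed direction from there, at a horizontal distance that has the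 conditional law of the horizontal distance between $O$ and $X^\star$ given that $X^\star$ is a UAV; directions and distances are independent of each other, between UAVs and of all else. For $\gamma>0$ and an integer $n\ge1$, let $\mathcal P_{\mathrm s}(\gamma)$ be the conditional probability of $\mathrm{SINR}>\gamma$ given the positions and line-of-sight states of all transmitters, and $M^{(\varsigma)}_{n|k}(\gamma)$ the conditional expectation of $\mathcal P_{\mathrm s}(\gamma)^n$ given that $X^\star$ belongs to tier $k$. **Statement.** Assume that at the UAV altitude a line-of-sight link is stronger than a non-line-of-sight link, that is, $\kappa_{\mathrm N}H_{\mathrm u}^{-\alpha_{\mathrm N}}<\kappa_{\mathrm L}H_{\mathrm u}^{-\alpha_{\mathrm L}}$. Then for $\varsigma\in\{\mathrm{SA},\mathrm{VA}\}$ and fixed $\lambda_{\mathrm b}>0$, $$\lim_{\lambda_{\mathrm u}\to\infty}A^{(\varsigma)}_{\mathrm b}=1-e^{-\pi\lambda_{\mathrm b}[(\chi^{(\varsigma)}_{\mathrm L,\mathrm b}(H_{\mathrm u}))^2-H_{\mathrm b}^2]},\qquad \lim_{\lambda_{\mathrm u}\to\infty}A^{(\varsigma)}_{\mathrm L}=e^{-\pi\lambda_{\mathrm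 b}[(\chi^{(\varsigma)}_{\mathrm L,\mathrm b}(H_{\mathrm u}))^2-H_{\mathrm b}^2]},\qquad \lim_{\lambda_{\mathrm u}\to\infty}A^{(\varsigma)}_{\mathrm N}=0;$$ for every $k\in\mathcal K$, $A_k^{(\varsigma)}>0$ for all $\lambda_{\mathrm u}>0$ (so that $M^{(\varsigma)}_{n|k}(\gamma)$ is well defined), and $\lim_{\lambda_{\mathrm u}\to\infty}M^{(\varsigma)}_{n|k}(\gamma)=0$ for all integers $n\ge1$ and all $\gamma>0$. If moreover $P_{\mathrm b}G_{\mathrm M,\mathrm b}\kappa_{\mathrm b}H_{\mathrm b}^{-\alpha_{\mathrm b}}\le P_{\mathrm u}G_{\mathrm M,\mathrm u}\kappa_{\mathrm L}H_{\mathrm u}^{-\alpha_{\mathrm L}}$, then $\lim_{\lambda_{\mathrm u}\to\infty}A^{(\varsigma)}_{\mathrm L}=1$. -/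

import Mathlib

open MeasureTheory ProbabilityTheory Filter Topology
open scoped ENNReal NNReal

noncomputable section

namespace UAVNet

/-- The three link conditions: ground-to-ground (`b`), air-to-ground line of sight (`L`) and
air-to-ground non line of sight (`N`). -/
inductive Tier
  | b | L | N

/-- Steerable (`SA`) or vertical (`VA`) antennas at the UAVs. -/
inductive Scenario
  | SA | VA

/-- The deterministic parameters of the network, apart from the two densities. -/
structure Params where
  /-- altitude of the terrestrial base stations (TBSs) -/
  Hb : ℝ
  /-- altitude of the UAVs -/
  Hu : ℝ
  /-- transmit power of the TBSs -/
  Pb : ℝ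
  /-- transmit power of the UAVs -/
  Pu : ℝ
  /-- maximal antenna gain of the TBSs -/
  GMb : ℝ
  /-- maximal antenna gain of the UAVs -/
  GMu : ℝ
  /-- beamwidth of the TBSs -/
  bwb : ℝ
  /-- beamwidth of the UAVs -/
  bwu : ℝ
  /-- side-lobe attenuation limit -/
  sla : ℝ
  /-- first environment parameter of the line-of-sight probability -/
  mua : ℝ
  /-- second environment parameter of the line-of-sight probability -/
  mub : ℝ
  /-- path-loss intercepts -/
  kap : Tier → ℝ
  /-- path-loss exponents -/
  alp : Tier → ℝ
  /-- fading (Gamma shape) parameters -/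
  fad : Tier → ℝ
  /-- thermal noise power -/
  N0 : ℝ
  Hb_pos : 0 < Hb
  Hu_pos : 0 < Hu
  Pb_pos : 0 < Pb
  Pu_pos : 0 < Pu
  GMb_pos : 0 < GMb
  GMu_pos : 0 < GMu
  bwb_pos : 0 < bwb
  bwu_pos : 0 < bwu
  sla_pos : 0 < sla
  mua_pos : 0 < mua
  mub_pos : 0 < mub
  kap_pos : ∀ k, 0 < kap k
  alp_pos : ∀ k, 0 < alp k
  fad_pos : ∀ k, 0 < fad k
  /-- Rayleigh fading on the ground-to-ground links -/
  fad_b : fad Tier.b = 1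
  N0_nonneg : 0 ≤ N0

/-- Antenna gain at angle `θ` off the boresight, for maximal gain `GM`, beamwidth `bw` and
side-lobe attenuation limit `sla`. -/
def gain (GM bw sla θ : ℝ) : ℝ :=
  GM * (10 : ℝ) ^ (-(min (12 * (θ / bw) ^ 2) sla))

namespace Params

variable (p : Params)

/-- Antenna gain of a TBS. -/
def Gb (θ : ℝ) : ℝ := gain p.GMb p.bwb p.sla θ

/-- Antenna gain of a UAV. -/
def Gu (θ : ℝ) : ℝ := gain p.GMu p.bwu p.sla θ

/-- Line-of-sight probability of an air-to-ground link of length `r`. -/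
def pLoS (r : ℝ) : ℝ :=
  1 / (1 + p.mua * Real.exp (-p.mub * (180 / Real.pi * Real.arcsin (p.Hu / r) - p.mua)))

/-- Altitude of the transmitters of a tier. -/
def alt : Tier → ℝ
  | Tier.b => p.Hb
  | Tier.L => p.Hu
  | Tier.N => p.Hu

/-- Average power received from a serving transmitter of tier `k` at link distance `r`. -/
def servPow (s : Scenario) (k : Tier) (r : ℝ) : ℝ :=
  match k, s with
  | Tier.b, _ => p.Pb * p.Gb (Real.arccos (p.Hb / r)) * p.kap Tier.b * r ^ (-(p.alp Tier.b))
  | k, Scenario.VA => p.Pu * p.Gu (Real.arccos (p.Hu / r)) * p.kap k * r ^ (-(p.alp k))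
  | k, Scenario.SA => p.Pu * p.Gu 0 * p.kap k * r ^ (-(p.alp k))

/-- The inverse function of `servPow s k`, which decreases strictly and continuously from its
value at the smallest possible distance `alt k` to `0`; a received power `y` that exceeds this
largest value is sent to `alt k`. -/
def servPowInv (s : Scenario) (k : Tier) (y : ℝ) : ℝ :=
  sInf {r : ℝ | p.alt k ≤ r ∧ p.servPow s k r ≤ y}

/-- The distance at which a transmitter of tier `l` is received as strongly as a transmitter of
tier `k` at distance `r`. -/
def chi (s : Scenario) (k l : Tier) (r : ℝ) : ℝ :=
  p.servPowInv s l (p.servPow s k r)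

end Params

/-! ### Poisson point processes -/

/-- Number of points of the sequence `x` in the set `B`. -/
def pointCount {E : Type*} (x : ℕ → E) (B : Set E) : ℝ≥0∞ :=
  ∑' i, B.indicator (fun _ => (1 : ℝ≥0∞)) (x i)

/-- `Q` is the law of an enumeration `X₀, X₁, …` of the points of a Poisson point process with
intensity measure `Λ`: numbers of points in disjoint sets are independent, and the number of
points in a set of finite intensity is Poisson distributed. -/
structure IsPoissonLaw {E : Type*} [MeasurableSpace E] (Λ : Measure E)
    (Q : Measure (ℕ → E)) : Prop where
  prob : IsProbabilityMeasure Q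
  poisson : ∀ B : Set E, MeasurableSet B → Λ B < ∞ → ∀ n : ℕ,
    Q {x | pointCount x B = n} = poissonMeasure (Λ B).toNNReal {n}
  indep : ∀ (n : ℕ) (B : Fin n → Set E), (∀ i, MeasurableSet (B i)) →
    Pairwise (fun i j => Disjoint (B i) (B j)) →
    iIndepFun (fun i (x : ℕ → E) => pointCount x (B i)) Q

/-- The ground plane. -/
abbrev Plane := EuclideanSpace ℝ (Fin 2)

/-- `Q` is the law of a homogeneous Poisson point process of density `lam` in the plane. -/
def IsPlanarPPP (lam : ℝ) (Q : Measure (ℕ → Plane)) : Prop :=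
  IsPoissonLaw (ENNReal.ofReal lam • (volume : Measure Plane)) Q

/-! ### The network seen from the typical user at the origin -/

/-- A realization of the network geometry: ground projections of the TBSs, ground projections of
the UAVs, and for each UAV a uniform variable that decides on its line-of-sight status. -/
abbrev Geometry := (ℕ → Plane) × (ℕ → Plane) × (ℕ → unitInterval)

/-- Law of the geometry: the TBS process, the UAV process and the line-of-sight variables are
independent. -/
def netLaw (Qb Qu : Measure (ℕ → Plane)) : Measure Geometry :=
  Qb.prod (Qu.prod (Measure.infinitePi fun _ : ℕ => (volume : Measure unitInterval)))

/-- Transmitters: `Sum.inl i` is the `i`-th TBS, `Sum.inr i` the `i`-th UAV. -/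
abbrev Tx := ℕ ⊕ ℕ

/-- Index of a transmitter within the TBSs or within the UAVs. -/
def idx : Tx → ℕ
  | Sum.inl i => i
  | Sum.inr i => i

/-- Ground projection of a transmitter. -/
def proj (g : Geometry) : Tx → Plane
  | Sum.inl i => g.1 i
  | Sum.inr i => g.2.1 i

namespace Params

variable (p : Params)

/-- Length of the link from a transmitter to the typical user. -/
def dist (g : Geometry) : Tx → ℝ
  | Sum.inl i => √(‖g.1 i‖ ^ 2 + p.Hb ^ 2)
  | Sum.inr i => √(‖g.2.1 i‖ ^ 2 + p.Hu ^ 2)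

open Classical in
/-- Tier of a transmitter. Given the positions, each UAV at distance `r` is in line of sight with
probability `pLoS r`, independently of all else. -/
def tier (g : Geometry) : Tx → Tier
  | Sum.inl _ => Tier.b
  | Sum.inr i => if (g.2.2 i : ℝ) ≤ p.pLoS (p.dist g (Sum.inr i)) then Tier.L else Tier.N

/-- Average power that the typical user would receive from a transmitter that serves it. -/
def rxPow (s : Scenario) (g : Geometry) (j : Tx) : ℝ :=
  p.servPow s (p.tier g j) (p.dist g j)

/-- The transmitter `j` provides the strongest average received power. -/
def IsServing (s : Scenario) (g : Geometry) (j : Tx) : Prop :=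
  ∀ j', p.rxPow s g j' ≤ p.rxPow s g j

/-- The event that the typical user is associated with tier `k`. -/
def assocEvent (s : Scenario) (k : Tier) : Set Geometry :=
  {g | ∃ j, p.tier g j = k ∧ p.IsServing s g j}

/-- Association probability of tier `k`. -/
def assocProb (s : Scenario) (Qb Qu : Measure (ℕ → Plane)) (k : Tier) : ℝ :=
  (netLaw Qb Qu).real (p.assocEvent s k)

/-! ### Small-scale fading and beams of the interfering UAVs -/

/-- Conditional distribution function of the horizontal distance between a user and its serving
transmitter, given that this transmitter is a UAV. -/
def uavUserCDF (s : Scenario) (Qb Qu : Measure (ℕ → Plane)) (t : ℝ) : ℝ :=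
  (netLaw Qb Qu).real {g | ∃ i, p.IsServing s g (Sum.inr i) ∧ ‖g.2.1 i‖ ≤ t} /
    (netLaw Qb Qu).real {g | ∃ i, p.IsServing s g (Sum.inr i)}

/-- Quantile function of `uavUserCDF`: at a uniform variable `u` it has that distribution. -/
def uavUserDist (s : Scenario) (Qb Qu : Measure (ℕ → Plane)) (u : ℝ) : ℝ :=
  sInf {t : ℝ | 0 ≤ t ∧ u ≤ p.uavUserCDF s Qb Qu t}

end Params

/-- The marks: fading gains `H_{k,i}`, and for each UAV two uniform variables, which give the
distance and the direction from its ground projection to the ground user that it serves. -/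
abbrev Marks := (Tier × ℕ → ℝ) × (ℕ → unitInterval × unitInterval)

/-- Angle at a UAV with ground projection `x` and altitude `H` between the directions to the
typical user at the origin and to the ground point `q`. -/
def offBoresight (H : ℝ) (x q : Plane) : ℝ :=
  EuclideanGeometry.angle (0 : EuclideanSpace ℝ (Fin 3)) !₂[x 0, x 1, H] !₂[q 0, q 1, 0]

namespace Params

variable (p : Params)

/-- Law of the marks: all are independent, `H_{k,i}` is Gamma distributed with shape `fad k` and
mean `1` (the second argument of `gammaMeasure` is the rate). -/
def markLaw : Measure Marks :=
  (Measure.infinitePi fun ki : Tier × ℕ => gammaMeasure (p.fad ki.1) (p.fad ki.1)).prod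
    (Measure.infinitePi fun _ : ℕ => (volume : Measure (unitInterval × unitInterval)))

/-- The ground point at which UAV `i` points its beam: the user that it serves (`SA`), or the
point below the UAV (`VA`). -/
def beamTarget (s : Scenario) (Qb Qu : Measure (ℕ → Plane)) (g : Geometry) (m : Marks) (i : ℕ) :
    Plane :=
  match s with
  | Scenario.SA =>
      g.2.1 i + p.uavUserDist Scenario.SA Qb Qu (m.2 i).1 •
        !₂[Real.cos (2 * Real.pi * (m.2 i).2), Real.sin (2 * Real.pi * (m.2 i).2)]
  | Scenario.VA => g.2.1 i

/-- Transmit power times antenna gain of an interfering transmitter towards the typical user. -/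
def interfGain (s : Scenario) (Qb Qu : Measure (ℕ → Plane)) (g : Geometry) (m : Marks) : Tx → ℝ
  | Sum.inl i => p.Pb * p.Gb (Real.arccos (p.Hb / p.dist g (Sum.inl i)))
  | Sum.inr i => p.Pu * p.Gu (offBoresight p.Hu (g.2.1 i) (p.beamTarget s Qb Qu g m i))

/-- Fading gain of the link from a transmitter to the typical user. -/
def fading (g : Geometry) (m : Marks) (j : Tx) : ℝ := m.1 (p.tier g j, idx j)

open Classical in
/-- Total interference (possibly infinite) when the typical user is served by `j`. -/
def interference (s : Scenario) (Qb Qu : Measure (ℕ → Plane)) (g : Geometry) (m : Marks)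
    (j : Tx) : ℝ≥0∞ :=
  ∑' j' : Tx, if j' = j then 0 else
    ENNReal.ofReal (p.interfGain s Qb Qu g m j' * p.fading g m j' * p.kap (p.tier g j') *
      p.dist g j' ^ (-(p.alp (p.tier g j'))))

/-- Received signal-to-interference-plus-noise ratio when the typical user is served by `j`. -/
def sinr (s : Scenario) (Qb Qu : Measure (ℕ → Plane)) (g : Geometry) (m : Marks) (j : Tx) :
    ℝ≥0∞ :=
  ENNReal.ofReal (p.rxPow s g j * p.fading g m j) /
    (ENNReal.ofReal p.N0 + p.interference s Qb Qu g m j)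

/-- Conditional success probability: probability, given the network geometry (positions and
line-of-sight states), that the SINR exceeds `γ`. -/
def csp (s : Scenario) (Qb Qu : Measure (ℕ → Plane)) (γ : ℝ) (g : Geometry) : ℝ≥0∞ :=
  p.markLaw {m | ∃ j, p.IsServing s g j ∧ ENNReal.ofReal γ < p.sinr s Qb Qu g m j}

/-- The `n`-th moment of the conditional success probability, given that the typical user is
associated with tier `k`. -/
def condMoment (s : Scenario) (Qb Qu : Measure (ℕ → Plane)) (γ : ℝ) (n : ℕ) (k : Tier) : ℝ≥0∞ :=
  ∫⁻ g, p.csp s Qb Qu γ g ^ n ∂((netLaw Qb Qu)[|p.assocEvent s k])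

end Params

end UAVNet

end

noncomputable section

namespace UAVNet

/-! ### Poisson counts -/

section Poisson

variable {E : Type*}

/-! Association. The line-of-sight probability is bounded away from 0, so by thinning a disc of any
radius δ > 0 contains no line-of-sight UAV with probability at most exp(-q·λ_u·π·δ²)
(`exists_noLoS_le`). For large λ_u a line-of-sight UAV is thus almost at the zenith. It beats every
non-line-of-sight UAV, which gives the limit for N, and every TBS whose horizontal distance slightly
exceeds `tbsRadius`, the radius that corresponds to `chi`. Conversely, a TBS within `tbsRadius`
beats every line-of-sight UAV, for every λ_u. These upper bounds are sharp because a serving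
transmitter exists almost surely: the three probabilities sum to at least 1, and each lower bound
follows from the other two upper bounds.

Moments. The conditioning event may itself have exponentially small probability, but not smaller
than that: one suitable transmitter near the origin and no other within a fixed radius give A_k ≥
c·exp(-C·λ_u) for λ_u ≥ 1 (`exists_le_assocProb`). It therefore suffices that the conditional
success probability is uniformly small off an event of probability O(exp(-(C+1)·λ_u)).

That event is `atypical`; its rate is made as large as needed by enlarging radii and thresholds
(`measure_atypical_le`). Off it, more than λ_u UAVs lie in a fixed disc. Each interferes with at
least a fixed multiple of its fading gain, because the antenna pattern has a positive side-lobe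
floor; the beam directions play no further role. Success then requires one Gamma variable to exceed
a multiple of a sum of about λ_u independent ones, which a Chernoff bound makes exponentially
unlikely (`exists_fading_tail`). A union bound over the O(λ_u) transmitters that may serve costs
only a linear factor. -/

lemma pointCount_eq_encard (x : ℕ → E) (B : Set E) :
    pointCount x B = ({i | x i ∈ B}.encard : ℝ≥0∞) := by
  rw [← ENNReal.tsum_set_one, tsum_subtype {i | x i ∈ B} (fun _ => (1 : ℝ≥0∞))]
  rfl

lemma exists_finset_of_pointCount_eq {x : ℕ → E} {B : Set E} {n : ℕ}
    (h : pointCount x B = n) : ∃ S : Finset ℕ, S.card = n ∧ ∀ i, x i ∈ B ↔ i ∈ S := by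
  rw [pointCount_eq_encard] at h
  have h' : {i | x i ∈ B}.encard = n := by exact_mod_cast h
  have hf : {i | x i ∈ B}.Finite := Set.finite_of_encard_eq_coe h'
  refine ⟨hf.toFinset, ?_, fun i => by simp⟩
  rw [hf.encard_eq_coe_toFinset_card] at h'
  exact_mod_cast h'

lemma pointCount_eq_zero_iff {x : ℕ → E} {B : Set E} :
    pointCount x B = 0 ↔ ∀ i, x i ∉ B := by
  simp [pointCount, ENNReal.tsum_eq_zero]

/-- Independent uniform marks: probability that all marks of the points in `B` lie in `I`. -/
lemma infinitePi_forall_mem {I : Set unitInterval} (hI : MeasurableSet I) {x : ℕ → E} {B : Set E} {n : ℕ}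
    (h : pointCount x B = n) :
    (Measure.infinitePi fun _ : ℕ => (volume : Measure unitInterval))
      {t | ∀ i, x i ∈ B → t i ∈ I} = volume I ^ n := by
  obtain ⟨S, hS, hi⟩ := exists_finset_of_pointCount_eq h
  have : {t : ℕ → unitInterval | ∀ i, x i ∈ B → t i ∈ I} = Set.pi S fun _ => I := by
    ext t
    simp [hi, Set.mem_pi]
  rw [this, Measure.infinitePi_pi _ (fun _ _ => hI)]
  simp [hS]

variable [MeasurableSpace E] {Λ : Measure E} {Q : Measure (ℕ → E)} {B : Set E}

lemma measurable_pointCount (hB : MeasurableSet B) :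
    Measurable fun x : ℕ → E => pointCount x B := by
  unfold pointCount
  exact Measurable.tsum fun i =>
    (measurable_const.indicator hB).comp (measurable_pi_apply i)

namespace IsPoissonLaw

lemma prob_count (hQ : IsPoissonLaw Λ Q) (hB : MeasurableSet B) (hΛ : Λ B < ∞) (n : ℕ) :
    Q {x | pointCount x B = n} =
      ENNReal.ofReal (Real.exp (-(Λ B).toReal) * (Λ B).toReal ^ n / n.factorial) := by
  rw [hQ.poisson B hB hΛ n, poissonMeasure_singleton]
  rfl

/-- The events of count n are disjoint and the Poisson weights sum to 1, so an infinite count has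
probability 0. -/
lemma ae_exists_count (hQ : IsPoissonLaw Λ Q) (hB : MeasurableSet B) (hΛ : Λ B < ∞) :
    ∀ᵐ x ∂Q, ∃ n : ℕ, pointCount x B = n := by
  have := hQ.prob
  have hm : ∀ n : ℕ, MeasurableSet {x : ℕ → E | pointCount x B = n} := fun n =>
    measurable_pointCount hB (measurableSet_singleton _)
  have hd : Pairwise (Function.onFun Disjoint fun n : ℕ => {x : ℕ → E | pointCount x B = n}) := by
    intro a b hab
    refine Set.disjoint_left.2 fun x hx hy => hab ?_
    have : (a : ℝ≥0∞) = b := hx.symm.trans hy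
    exact_mod_cast this
  have h1 : Q (⋃ n : ℕ, {x | pointCount x B = n}) = 1 := by
    rw [measure_iUnion hd hm]
    have h2 : ∀ n : ℕ, Q {x | pointCount x B = n} = poissonMeasure (Λ B).toNNReal {n} :=
      fun n => hQ.poisson B hB hΛ n
    simp_rw [h2]
    rw [← lintegral_one (μ := poissonMeasure (Λ B).toNNReal) |>.trans measure_univ,
      lintegral_countable']
    simp
  have h3 := (prob_compl_eq_zero_iff (MeasurableSet.iUnion hm)).2 h1
  rw [ae_iff]
  convert h3 using 2
  ext x
  simp

/-- This is the generating function E[z^N] = exp((z-1)·Λ B) of the Poisson count. It serves three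
times: z = e and z = 1/e give the two tails, and z = `volume I` gives independent thinning. `F` may
be any function, so no measurability has to be checked for it. -/
lemma lintegral_le (hQ : IsPoissonLaw Λ Q) (hB : MeasurableSet B) (hΛ : Λ B < ∞) {z : ℝ}
    (hz : 0 ≤ z) {F : (ℕ → E) → ℝ≥0∞}
    (hF : ∀ (n : ℕ) x, pointCount x B = n → F x ≤ ENNReal.ofReal (z ^ n)) :
    ∫⁻ x, F x ∂Q ≤ ENNReal.ofReal (Real.exp ((z - 1) * (Λ B).toReal)) := by
  have hm : ∀ n : ℕ, MeasurableSet {x : ℕ → E | pointCount x B = n} := fun n =>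
    measurable_pointCount hB (measurableSet_singleton _)
  have hr := hQ.ae_exists_count hB hΛ
  set r := (Λ B).toReal with hrdef
  have hr0 : 0 ≤ r := ENNReal.toReal_nonneg
  calc ∫⁻ x, F x ∂Q
      ≤ ∫⁻ x, ∑' n : ℕ, {x : ℕ → E | pointCount x B = n}.indicator
          (fun _ => ENNReal.ofReal (z ^ n)) x ∂Q := by
        refine lintegral_mono_ae ?_
        filter_upwards [hr] with x ⟨n, hn⟩
        refine (hF n x hn).trans (le_trans ?_ (ENNReal.le_tsum n))
        rw [Set.indicator_of_mem (by exact hn)]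
    _ = ∑' n : ℕ, ENNReal.ofReal (z ^ n) * Q {x | pointCount x B = n} := by
        rw [lintegral_tsum fun n => (measurable_const.indicator (hm n)).aemeasurable]
        congr 1 with n
        rw [lintegral_indicator_const (hm n)]
    _ = ∑' n : ℕ, ENNReal.ofReal (Real.exp (-r) * ((z * r) ^ n / n.factorial)) := by
        congr 1 with n
        rw [hQ.prob_count hB hΛ n, ← ENNReal.ofReal_mul (by positivity)]
        congr 1
        rw [mul_pow, ← hrdef]
        ring
    _ = ENNReal.ofReal (Real.exp ((z - 1) * r)) := by
        have hs := (NormedSpace.expSeries_div_hasSum_exp (𝔸 := ℝ) (z * r)).mul_left (Real.exp (-r))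
        rw [← ENNReal.ofReal_tsum_of_nonneg (fun n => by positivity) hs.summable, hs.tsum_eq,
          ← Real.exp_eq_exp_ℝ, ← Real.exp_add]
        congr 2
        ring
    _ ≤ _ := le_rfl

/-- Chernoff bound with z = e: the indicator of N ≥ m is at most exp(N - m), and e - 1 ≤ 2. -/
lemma prob_le_count (hQ : IsPoissonLaw Λ Q) (hB : MeasurableSet B) (hΛ : Λ B < ∞) (m : ℝ) :
    Q {x | ENNReal.ofReal m ≤ pointCount x B} ≤
      ENNReal.ofReal (Real.exp (2 * (Λ B).toReal - m)) := by
  have hs : MeasurableSet {x : ℕ → E | ENNReal.ofReal m ≤ pointCount x B} :=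
    measurableSet_le measurable_const (measurable_pointCount hB)
  have h := hQ.lintegral_le hB hΛ (Real.exp_pos 1).le
    (F := fun x => ENNReal.ofReal (Real.exp m) *
      {x : ℕ → E | ENNReal.ofReal m ≤ pointCount x B}.indicator 1 x) (by
      intro n x hn
      by_cases hx : ENNReal.ofReal m ≤ pointCount x B
      · rw [Set.indicator_of_mem (by exact hx), Pi.one_apply, mul_one, ← Real.exp_nat_mul, mul_one]
        rw [hn] at hx
        refine ENNReal.ofReal_le_ofReal (Real.exp_le_exp.2 ?_)
        have := ENNReal.toReal_mono (by simp) hx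
        simp only [ENNReal.toReal_natCast] at this
        exact (Real.le_coe_toNNReal m).trans this
      · rw [Set.indicator_of_notMem (by exact hx)]
        simp)
  rw [lintegral_const_mul _ (measurable_one.indicator hs), lintegral_indicator_one hs] at h
  have h2 : Q {x | ENNReal.ofReal m ≤ pointCount x B} = ENNReal.ofReal (Real.exp (-m)) *
      (ENNReal.ofReal (Real.exp m) * Q {x | ENNReal.ofReal m ≤ pointCount x B}) := by
    rw [← mul_assoc, ← ENNReal.ofReal_mul (Real.exp_pos _).le, ← Real.exp_add]
    simp
  rw [h2]
  refine (mul_le_mul_right h _).trans ?_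
  rw [← ENNReal.ofReal_mul (Real.exp_pos _).le, ← Real.exp_add]
  refine ENNReal.ofReal_le_ofReal (Real.exp_le_exp.2 ?_)
  have := Real.exp_one_lt_d9
  have : 0 ≤ (Λ B).toReal := ENNReal.toReal_nonneg
  nlinarith

/-- Chernoff bound with z = 1/e: the indicator of N ≤ m is at most exp(m - N), and 1 - 1/e ≥ 1/2. -/
lemma prob_count_le (hQ : IsPoissonLaw Λ Q) (hB : MeasurableSet B) (hΛ : Λ B < ∞) {m : ℝ}
    (hm : 0 ≤ m) :
    Q {x | pointCount x B ≤ ENNReal.ofReal m} ≤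
      ENNReal.ofReal (Real.exp (m - (Λ B).toReal / 2)) := by
  have hs : MeasurableSet {x : ℕ → E | pointCount x B ≤ ENNReal.ofReal m} :=
    measurableSet_le (measurable_pointCount hB) measurable_const
  have h := hQ.lintegral_le hB hΛ (Real.exp_pos (-1)).le
    (F := fun x => ENNReal.ofReal (Real.exp (-m)) *
      {x : ℕ → E | pointCount x B ≤ ENNReal.ofReal m}.indicator 1 x) (by
      intro n x hn
      by_cases hx : pointCount x B ≤ ENNReal.ofReal m
      · rw [Set.indicator_of_mem (by exact hx), Pi.one_apply, mul_one, ← Real.exp_nat_mul]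
        rw [hn] at hx
        refine ENNReal.ofReal_le_ofReal (Real.exp_le_exp.2 ?_)
        have := ENNReal.toReal_mono (by simp) hx
        rw [ENNReal.toReal_natCast, ENNReal.toReal_ofReal hm] at this
        linarith
      · rw [Set.indicator_of_notMem (by exact hx)]
        simp)
  rw [lintegral_const_mul _ (measurable_one.indicator hs), lintegral_indicator_one hs] at h
  have h2 : Q {x | pointCount x B ≤ ENNReal.ofReal m} = ENNReal.ofReal (Real.exp m) *
      (ENNReal.ofReal (Real.exp (-m)) * Q {x | pointCount x B ≤ ENNReal.ofReal m}) := by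
    rw [← mul_assoc, ← ENNReal.ofReal_mul (Real.exp_pos _).le, ← Real.exp_add]
    simp
  rw [h2]
  refine (mul_le_mul_right h _).trans ?_
  rw [← ENNReal.ofReal_mul (Real.exp_pos _).le, ← Real.exp_add]
  refine ENNReal.ofReal_le_ofReal (Real.exp_le_exp.2 ?_)
  have h3 : Real.exp (-1) ≤ 1 / 2 := by
    rw [Real.exp_neg, inv_eq_one_div]
    have := Real.exp_one_gt_d9
    gcongr
    linarith
  have : 0 ≤ (Λ B).toReal := ENNReal.toReal_nonneg
  nlinarith

lemma prob_one_and_none (hQ : IsPoissonLaw Λ Q) {A : Set E} (hA : MeasurableSet A)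
    (hB : MeasurableSet B) (hd : Disjoint A B) (hΛA : Λ A < ∞) (hΛB : Λ B < ∞) :
    Q {x | pointCount x A = 1 ∧ pointCount x B = 0} =
      ENNReal.ofReal ((Λ A).toReal * Real.exp (-((Λ A).toReal + (Λ B).toReal))) := by
  have hi := hQ.indep 2 ![A, B] (by
    intro i
    fin_cases i
    · exact hA
    · exact hB) (by
    intro i j hij
    fin_cases i <;> fin_cases j
    · exact absurd rfl hij
    · exact hd
    · exact hd.symm
    · exact absurd rfl hij)
  have h2 := (hi.indepFun (i := 0) (j := 1) (by decide)).measure_inter_preimage_eq_mul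
    {1} {0} (measurableSet_singleton _) (measurableSet_singleton _)
  have e1 := hQ.prob_count hA hΛA 1
  have e0 := hQ.prob_count hB hΛB 0
  simp only [Nat.cast_one, Nat.cast_zero] at e1 e0
  change Q {x | pointCount x A = 1 ∧ pointCount x B = 0} =
    Q {x | pointCount x A = 1} * Q {x | pointCount x B = 0} at h2
  rw [h2, e1, e0, ← ENNReal.ofReal_mul (by positivity)]
  congr 1
  rw [neg_add, Real.exp_add]
  simp
  ring

end IsPoissonLaw

/-! ### Poisson processes with independent uniform marks. -/

lemma measurableSet_marks {I : Set unitInterval} (hI : MeasurableSet I) (hB : MeasurableSet B) :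
    MeasurableSet {y : (ℕ → E) × (ℕ → unitInterval) | ∀ i, y.1 i ∈ B → y.2 i ∈ I} := by
  rw [Set.ofPred_forall]
  refine MeasurableSet.iInter fun i => ?_
  have h1 : MeasurableSet {y : (ℕ → E) × (ℕ → unitInterval) | y.1 i ∈ B} :=
    ((measurable_pi_apply i).comp measurable_fst) hB
  have h2 : MeasurableSet {y : (ℕ → E) × (ℕ → unitInterval) | y.2 i ∈ I} :=
    ((measurable_pi_apply i).comp measurable_snd) hI
  have : {y : (ℕ → E) × (ℕ → unitInterval) | y.1 i ∈ B → y.2 i ∈ I} =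
      {y | y.1 i ∈ B}ᶜ ∪ {y | y.2 i ∈ I} := by
    ext y
    simp [imp_iff_not_or]
  rw [this]
  exact h1.compl.union h2

/-- Given n points in `B`, all their marks lie in `I` with probability (vol I)^n; averaging over n
is the generating function at z = vol I. The result is the void probability of the thinned process
of points with marks outside `I`. -/
lemma IsPoissonLaw.prob_marks_le (hQ : IsPoissonLaw Λ Q) (hB : MeasurableSet B) (hΛ : Λ B < ∞)
    {I : Set unitInterval} (hI : MeasurableSet I) :
    (Q.prod (Measure.infinitePi fun _ : ℕ => (volume : Measure unitInterval)))
      {y | ∀ i, y.1 i ∈ B → y.2 i ∈ I} ≤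
        ENNReal.ofReal (Real.exp (-((1 - (volume I).toReal) * (Λ B).toReal))) := by
  have := hQ.prob
  rw [Measure.prod_apply (measurableSet_marks hI hB)]
  refine (hQ.lintegral_le hB hΛ (z := (volume I).toReal) ENNReal.toReal_nonneg ?_).trans ?_
  · intro n x hn
    change (Measure.infinitePi fun _ : ℕ => (volume : Measure unitInterval))
      {t | ∀ i, x i ∈ B → t i ∈ I} ≤ _
    rw [infinitePi_forall_mem hI hn, ENNReal.ofReal_pow ENNReal.toReal_nonneg,
      ENNReal.ofReal_toReal (measure_ne_top _ _)]
  · apply le_of_eq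
    congr 2
    ring

lemma IsPoissonLaw.prob_one_marks (hQ : IsPoissonLaw Λ Q) {A : Set E} (hA : MeasurableSet A)
    (hB : MeasurableSet B) (hd : Disjoint A B) (hΛA : Λ A < ∞) (hΛB : Λ B < ∞)
    {I : Set unitInterval} (hI : MeasurableSet I) :
    (Q.prod (Measure.infinitePi fun _ : ℕ => (volume : Measure unitInterval)))
      {y | (pointCount y.1 A = 1 ∧ pointCount y.1 B = 0) ∧ ∀ i, y.1 i ∈ A → y.2 i ∈ I} =
        volume I *
        ENNReal.ofReal ((Λ A).toReal * Real.exp (-((Λ A).toReal + (Λ B).toReal))) := by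
  have := hQ.prob
  have hm : MeasurableSet {x : ℕ → E | pointCount x A = 1 ∧ pointCount x B = 0} :=
    (measurable_pointCount hA (measurableSet_singleton 1)).inter
      (measurable_pointCount hB (measurableSet_singleton 0))
  have hm' : MeasurableSet {y : (ℕ → E) × (ℕ → unitInterval) |
      (pointCount y.1 A = 1 ∧ pointCount y.1 B = 0) ∧ ∀ i, y.1 i ∈ A → y.2 i ∈ I} :=
    (measurable_fst hm).inter (measurableSet_marks hI hA)
  rw [Measure.prod_apply hm', ← hQ.prob_one_and_none hA hB hd hΛA hΛB,
    ← lintegral_indicator_const hm]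
  refine lintegral_congr fun x => ?_
  by_cases hx : pointCount x A = 1 ∧ pointCount x B = 0
  · rw [Set.indicator_of_mem (by exact hx)]
    have h1 : pointCount x A = (1 : ℕ) := by simpa using hx.1
    rw [← pow_one (volume I), ← infinitePi_forall_mem hI h1]
    congr 1
    ext t
    simp [hx]
  · rw [Set.indicator_of_notMem (by exact hx)]
    convert measure_empty (μ := Measure.infinitePi fun _ : ℕ => (volume : Measure unitInterval))
    ext t
    simp only [Set.mem_preimage, Set.mem_ofPred_eq, Set.mem_empty_iff_false, iff_false]
    exact fun h => hx h.1

end Poisson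

/-! ### Planar intensities -/

/-- The disc of radius `r` around the origin. -/
def disc (r : ℝ) : Set Plane := Metric.ball 0 r

lemma mem_disc {x : Plane} {r : ℝ} : x ∈ disc r ↔ ‖x‖ < r := mem_ball_zero_iff

lemma measurableSet_disc (r : ℝ) : MeasurableSet (disc r) := measurableSet_ball

lemma volume_disc {r : ℝ} (hr : 0 ≤ r) :
    (volume : Measure Plane) (disc r) = ENNReal.ofReal (Real.pi * r ^ 2) := by
  rw [disc, EuclideanSpace.volume_ball_fin_two, ← ENNReal.ofReal_pow hr,
    ← ENNReal.ofReal_mul (by positivity), mul_comm]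

lemma intensity_disc_lt_top (lam : ℝ) {r : ℝ} (hr : 0 ≤ r) :
    (ENNReal.ofReal lam • (volume : Measure Plane)) (disc r) < ∞ := by
  simp [volume_disc hr, ENNReal.mul_lt_top]

lemma intensity_disc {lam r : ℝ} (hl : 0 ≤ lam) (hr : 0 ≤ r) :
    ((ENNReal.ofReal lam • (volume : Measure Plane)) (disc r)).toReal =
      lam * (Real.pi * r ^ 2) := by
  have : 0 ≤ Real.pi * r ^ 2 := by positivity
  simp [volume_disc hr, ENNReal.toReal_mul, ENNReal.toReal_ofReal hl, ENNReal.toReal_ofReal this]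

lemma intensity_shell_lt_top (lam : ℝ) {r : ℝ} (hr : 0 ≤ r) :
    (ENNReal.ofReal lam • (volume : Measure Plane)) (disc r \ disc 1) < ∞ :=
  (measure_mono Set.sdiff_subset).trans_lt (intensity_disc_lt_top lam hr)

lemma intensity_shell {lam r : ℝ} (hl : 0 ≤ lam) (hr : 1 ≤ r) :
    ((ENNReal.ofReal lam • (volume : Measure Plane)) (disc r \ disc 1)).toReal =
      lam * (Real.pi * r ^ 2) - lam * (Real.pi * 1 ^ 2) := by
  have hr0 : 0 ≤ r := zero_le_one.trans hr
  have hsub : disc 1 ⊆ disc r := Metric.ball_subset_ball hr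
  rw [measure_sdiff hsub (measurableSet_disc 1).nullMeasurableSet
    (intensity_disc_lt_top lam zero_le_one).ne, ENNReal.toReal_sub_of_le
    (measure_mono hsub) (intensity_disc_lt_top lam hr0).ne,
    intensity_disc hl hr0, intensity_disc hl zero_le_one]

/-! ### Gains, line-of-sight probabilities and received powers -/

lemma gain_le {GM bw sla θ : ℝ} (hG : 0 < GM) (hs : 0 < sla) : gain GM bw sla θ ≤ GM := by
  have h : (10 : ℝ) ^ (-(min (12 * (θ / bw) ^ 2) sla)) ≤ 1 :=
    Real.rpow_le_one_of_one_le_of_nonpos (by norm_num) (by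
      have : 0 ≤ min (12 * (θ / bw) ^ 2) sla := le_min (by positivity) hs.le
      linarith)
  unfold gain
  nlinarith

/-- The side-lobe floor holds at every angle, so interference can be bounded below without knowing
where the beams point. -/
lemma le_gain {GM bw sla θ : ℝ} (hG : 0 < GM) : GM * (10 : ℝ) ^ (-sla) ≤ gain GM bw sla θ := by
  unfold gain
  refine mul_le_mul_of_nonneg_left ?_ hG.le
  exact Real.rpow_le_rpow_of_exponent_le (by norm_num) (neg_le_neg (min_le_right _ _))

lemma gain_pos {GM bw sla θ : ℝ} (hG : 0 < GM) : 0 < gain GM bw sla θ := by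
  unfold gain
  positivity

lemma gain_zero {GM bw sla : ℝ} (hs : 0 < sla) : gain GM bw sla 0 = GM := by
  simp [gain, hs.le]

lemma gain_anti {GM bw sla θ φ : ℝ} (hG : 0 < GM) (hθ : 0 ≤ θ) (h : θ ≤ φ) (hb : 0 < bw) :
    gain GM bw sla φ ≤ gain GM bw sla θ := by
  unfold gain
  refine mul_le_mul_of_nonneg_left ?_ hG.le
  refine Real.rpow_le_rpow_of_exponent_le (by norm_num) (neg_le_neg (min_le_min ?_ le_rfl))
  gcongr

lemma continuous_gain (GM bw sla : ℝ) : Continuous (gain GM bw sla) := by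
  unfold gain
  refine continuous_const.mul ?_
  exact Continuous.rpow (by fun_prop) (by fun_prop) (by norm_num)

namespace Params

variable (p : Params)

/-- The elevation angle in degrees stays within [-90, 90]. Uniform bounds let fixed thresholds on
the marks decide the tier irrespective of the distance. -/
lemma exists_pLoS_bounds :
    ∃ q₀ q₁ : ℝ, 0 < q₀ ∧ q₀ ≤ q₁ ∧ q₁ < 1 ∧ ∀ r, q₀ ≤ p.pLoS r ∧ p.pLoS r ≤ q₁ := by
  have ha := p.mua_pos
  have hb := p.mub_pos
  have hpi := Real.pi_pos
  have hL : ∀ x, 180 / Real.pi * Real.arcsin x ≤ 90 := fun x => by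
    calc 180 / Real.pi * Real.arcsin x ≤ 180 / Real.pi * (Real.pi / 2) :=
          mul_le_mul_of_nonneg_left (Real.arcsin_le_pi_div_two x) (by positivity)
      _ = 90 := by field_simp; norm_num
  have hU : ∀ x, -90 ≤ 180 / Real.pi * Real.arcsin x := fun x => by
    calc (-90 : ℝ) = 180 / Real.pi * (-(Real.pi / 2)) := by field_simp; norm_num
      _ ≤ _ := mul_le_mul_of_nonneg_left (Real.neg_pi_div_two_le_arcsin x) (by positivity)
  have key : ∀ r, 1 / (1 + p.mua * Real.exp (p.mub * (90 + p.mua))) ≤ p.pLoS r ∧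
      p.pLoS r ≤ 1 / (1 + p.mua * Real.exp (-(p.mub * 90))) := by
    intro r
    unfold pLoS
    have h1 := hL (p.Hu / r)
    have h2 := hU (p.Hu / r)
    constructor
    · refine one_div_le_one_div_of_le (by positivity) (add_le_add_right
        (mul_le_mul_of_nonneg_left (Real.exp_le_exp.2 ?_) ha.le) 1)
      nlinarith
    · refine one_div_le_one_div_of_le (by positivity) (add_le_add_right
        (mul_le_mul_of_nonneg_left (Real.exp_le_exp.2 ?_) ha.le) 1)
      nlinarith
  refine ⟨_, _, ?_, (key 0).1.trans (key 0).2, ?_, key⟩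
  · positivity
  · rw [div_lt_one (by positivity)]
    have : 0 < p.mua * Real.exp (-(p.mub * 90)) := by positivity
    linarith

lemma alt_pos (k : Tier) : 0 < p.alt k := by
  cases k
  exacts [p.Hb_pos, p.Hu_pos, p.Hu_pos]

/-- Directivity factor of a serving transmitter, as a function of the link distance. -/
def servGain (s : Scenario) (k : Tier) (r : ℝ) : ℝ :=
  match k, s with
  | Tier.b, _ => p.Pb * p.Gb (Real.arccos (p.Hb / r))
  | _, Scenario.VA => p.Pu * p.Gu (Real.arccos (p.Hu / r))
  | _, Scenario.SA => p.Pu * p.Gu 0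

/-- Upper bound of the directivity factor of a serving transmitter. -/
def maxGain : Tier → ℝ
  | Tier.b => p.Pb * p.GMb
  | _ => p.Pu * p.GMu

lemma servPow_eq (s : Scenario) (k : Tier) (r : ℝ) :
    p.servPow s k r = p.servGain s k r * p.kap k * r ^ (-(p.alp k)) := by
  cases k <;> cases s <;> rfl

lemma servGain_pos (s : Scenario) (k : Tier) (r : ℝ) : 0 < p.servGain s k r := by
  cases k <;> cases s
  all_goals first
    | exact mul_pos p.Pb_pos (gain_pos p.GMb_pos)
    | exact mul_pos p.Pu_pos (gain_pos p.GMu_pos)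

lemma maxGain_pos (k : Tier) : 0 < p.maxGain k := by
  cases k
  exacts [mul_pos p.Pb_pos p.GMb_pos, mul_pos p.Pu_pos p.GMu_pos, mul_pos p.Pu_pos p.GMu_pos]

lemma servGain_le (s : Scenario) (k : Tier) (r : ℝ) : p.servGain s k r ≤ p.maxGain k := by
  cases k <;> cases s
  all_goals first
    | exact mul_le_mul_of_nonneg_left (gain_le p.GMb_pos p.sla_pos) p.Pb_pos.le
    | exact mul_le_mul_of_nonneg_left (gain_le p.GMu_pos p.sla_pos) p.Pu_pos.le

lemma arccos_div_mono {H r t : ℝ} (hH : 0 < H) (hr : H ≤ r) (h : r ≤ t) :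
    Real.arccos (H / r) ≤ Real.arccos (H / t) :=
  Real.arccos_le_arccos (div_le_div_of_nonneg_left hH.le (hH.trans_le hr) h)

lemma servGain_anti (s : Scenario) (k : Tier) {r t : ℝ} (hr : p.alt k ≤ r) (h : r ≤ t) :
    p.servGain s k t ≤ p.servGain s k r := by
  cases k <;> cases s
  all_goals first
    | exact le_rfl
    | exact mul_le_mul_of_nonneg_left (gain_anti p.GMb_pos (Real.arccos_nonneg _)
        (arccos_div_mono p.Hb_pos hr h) p.bwb_pos) p.Pb_pos.le
    | exact mul_le_mul_of_nonneg_left (gain_anti p.GMu_pos (Real.arccos_nonneg _)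
        (arccos_div_mono p.Hu_pos hr h) p.bwu_pos) p.Pu_pos.le

lemma servPow_pos (s : Scenario) (k : Tier) {r : ℝ} (hr : 0 < r) : 0 < p.servPow s k r := by
  rw [servPow_eq]
  have := p.servGain_pos s k r
  have := p.kap_pos k
  positivity

lemma servPow_strictAnti (s : Scenario) (k : Tier) {r t : ℝ} (hr : p.alt k ≤ r) (h : r < t) :
    p.servPow s k t < p.servPow s k r := by
  have h0 := (p.alt_pos k).trans_le hr
  have h1 := p.servGain_pos s k r
  have h2 := p.kap_pos k
  rw [servPow_eq, servPow_eq]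
  calc p.servGain s k t * p.kap k * t ^ (-(p.alp k))
      ≤ p.servGain s k r * p.kap k * t ^ (-(p.alp k)) := by
        have := p.servGain_anti s k hr h.le
        have := h0.trans h
        gcongr
    _ < _ := by
        refine mul_lt_mul_of_pos_left ?_ (by positivity)
        exact Real.rpow_lt_rpow_of_neg h0 h (neg_lt_zero.2 (p.alp_pos k))

lemma servPow_anti (s : Scenario) (k : Tier) {r t : ℝ} (hr : p.alt k ≤ r) (h : r ≤ t) :
    p.servPow s k t ≤ p.servPow s k r := by
  rcases h.eq_or_lt with rfl | h
  · exact le_rfl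
  · exact (p.servPow_strictAnti s k hr h).le

/-- At the zenith the vertical beam also points at the user, so both scenarios have the same maximal
power. -/
lemma servPow_alt (s : Scenario) (k : Tier) :
    p.servPow s k (p.alt k) = p.maxGain k * p.kap k * p.alt k ^ (-(p.alp k)) := by
  have hb : p.Hb / p.Hb = 1 := div_self p.Hb_pos.ne'
  have hu : p.Hu / p.Hu = 1 := div_self p.Hu_pos.ne'
  rw [servPow_eq]
  congr 2
  cases k <;> cases s <;>
    simp [servGain, maxGain, alt, hb, hu, Gb, Gu, gain_zero p.sla_pos]

/-- Bounded gains times a decaying power of the distance; the radius is uniform over the three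
tiers. -/
lemma exists_forall_servPow_lt (s : Scenario) {τ : ℝ} (hτ : 0 < τ) :
    ∃ ρ : ℝ, 1 ≤ ρ ∧ ∀ k r, ρ ≤ r → p.servPow s k r < τ := by
  have key : ∀ k, ∃ ρ : ℝ, ∀ r, ρ ≤ r → p.servPow s k r < τ := by
    intro k
    have ht : Tendsto (fun r : ℝ => p.maxGain k * p.kap k * r ^ (-(p.alp k))) atTop (𝓝 0) := by
      simpa using (tendsto_rpow_neg_atTop (p.alp_pos k)).const_mul (p.maxGain k * p.kap k)
    obtain ⟨ρ, hρ⟩ := ((ht.eventually_lt_const hτ).and (eventually_gt_atTop 0)).exists_forall_of_atTop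
    refine ⟨ρ, fun r hr => lt_of_le_of_lt ?_ (hρ r hr).1⟩
    rw [servPow_eq]
    have := p.servGain_le s k r
    have := p.kap_pos k
    have := (hρ r hr).2
    gcongr
  choose f hf using key
  refine ⟨max 1 (max (f Tier.b) (max (f Tier.L) (f Tier.N))), le_max_left _ _, fun k r hr => ?_⟩
  refine hf k r (le_trans ?_ hr)
  cases k <;> simp

/-- Link distance of a transmitter of tier `k` at horizontal distance `x`. -/
def link (k : Tier) (x : ℝ) : ℝ := √(x ^ 2 + p.alt k ^ 2)

lemma alt_le_link (k : Tier) (x : ℝ) : p.alt k ≤ p.link k x :=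
  Real.le_sqrt_of_sq_le (by nlinarith [sq_nonneg x])

lemma link_pos (k : Tier) (x : ℝ) : 0 < p.link k x := (p.alt_pos k).trans_le (p.alt_le_link k x)

lemma le_link (k : Tier) (x : ℝ) : x ≤ p.link k x :=
  Real.le_sqrt_of_sq_le (by nlinarith [sq_nonneg (p.alt k)])

lemma link_mono (k : Tier) {x y : ℝ} (hx : 0 ≤ x) (h : x ≤ y) : p.link k x ≤ p.link k y :=
  Real.sqrt_le_sqrt (by gcongr)

lemma link_zero (k : Tier) : p.link k 0 = p.alt k := by
  simp [link, Real.sqrt_sq (p.alt_pos k).le]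

lemma continuous_link (k : Tier) : Continuous (p.link k) := by
  unfold link
  fun_prop

lemma continuousAt_servPow (s : Scenario) (k : Tier) {r : ℝ} (hr : 0 < r) :
    ContinuousAt (p.servPow s k) r := by
  have e : p.servPow s k = fun r => p.servGain s k r * p.kap k * r ^ (-(p.alp k)) :=
    funext fun r => p.servPow_eq s k r
  rw [e]
  have hdiv : ∀ H : ℝ, ContinuousAt (fun r : ℝ => Real.arccos (H / r)) r := fun H =>
    Real.continuous_arccos.continuousAt.comp (continuousAt_const.div continuousAt_id hr.ne')
  have hg : ContinuousAt (p.servGain s k) r := by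
    cases k <;> cases s
    all_goals first
      | exact continuousAt_const
      | exact continuousAt_const.mul
          ((continuous_gain _ _ _).continuousAt.comp (hdiv _))
  exact (hg.mul continuousAt_const).mul (Real.continuousAt_rpow_const _ _ (Or.inl hr.ne'))

/-- Close to the zenith, the received power exceeds any value below its maximum. -/
lemma exists_lt_servPow_link (s : Scenario) (k : Tier) {τ : ℝ}
    (h : τ < p.servPow s k (p.alt k)) : ∃ δ : ℝ, 0 < δ ∧ τ < p.servPow s k (p.link k δ) := by
  have hc : ContinuousAt (fun x => p.servPow s k (p.link k x)) 0 :=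
    ContinuousAt.comp (g := p.servPow s k) (f := p.link k)
      (by rw [link_zero]; exact p.continuousAt_servPow s k (p.alt_pos k))
      (p.continuous_link k).continuousAt
  have h2 : ∀ᶠ x in 𝓝 (0 : ℝ), τ < p.servPow s k (p.link k x) :=
    hc.eventually_const_lt (by simpa only [link_zero] using h)
  have h3 : ∀ᶠ x in 𝓝[>] (0 : ℝ), τ < p.servPow s k (p.link k x) ∧ 0 < x :=
    (h2.filter_mono nhdsWithin_le_nhds).and self_mem_nhdsWithin
  obtain ⟨x, hx⟩ := h3.exists
  exact ⟨x, hx.2, hx.1⟩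

/-! ### The equal-power distance. -/

section chi

variable (s : Scenario) (k l : Tier) (r : ℝ)

lemma chi_bddBelow (y : ℝ) : BddBelow {r : ℝ | p.alt l ≤ r ∧ p.servPow s l r ≤ y} :=
  ⟨p.alt l, fun _ h => h.1⟩

lemma chi_nonempty {y : ℝ} (hy : 0 < y) : {r : ℝ | p.alt l ≤ r ∧ p.servPow s l r ≤ y}.Nonempty := by
  obtain ⟨ρ, -, hρ⟩ := p.exists_forall_servPow_lt s hy
  exact ⟨max ρ (p.alt l), le_max_right _ _, (hρ l _ (le_max_left _ _)).le⟩

variable {r}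

lemma alt_le_chi (hr : 0 < r) : p.alt l ≤ p.chi s k l r :=
  le_csInf (p.chi_nonempty s l (p.servPow_pos s k hr)) fun _ h => h.1

variable {s k l}

/-- Strict monotonicity absorbs the infimum: some admissible u < t already has power at most the
target, so it need not be known that the infimum is attained. -/
lemma servPow_lt_of_chi_lt (hr : 0 < r) {t : ℝ} (h : p.chi s k l r < t) :
    p.servPow s l t < p.servPow s k r := by
  obtain ⟨u, hu, hut⟩ := exists_lt_of_csInf_lt (p.chi_nonempty s l (p.servPow_pos s k hr)) h
  exact (p.servPow_strictAnti s l hu.1 hut).trans_le hu.2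

lemma lt_servPow_of_lt_chi {t : ℝ} (ht : p.alt l ≤ t) (h : t < p.chi s k l r) :
    p.servPow s k r < p.servPow s l t := by
  by_contra! hc
  exact absurd (csInf_le (p.chi_bddBelow s l _) ⟨ht, hc⟩) (not_le.2 h)

lemma chi_eq_alt (h : p.servPow s l (p.alt l) ≤ p.servPow s k r) : p.chi s k l r = p.alt l :=
  le_antisymm (csInf_le (p.chi_bddBelow s l _) ⟨le_rfl, h⟩)
    (le_csInf ⟨_, le_rfl, h⟩ fun _ h => h.1)

end chi

end Params

/-! ### The network geometry -/

/-- Law of the line-of-sight variables. -/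
abbrev losLaw : Measure (ℕ → unitInterval) :=
  Measure.infinitePi fun _ : ℕ => (volume : Measure unitInterval)

section netLaw

variable {Qb Qu : Measure (ℕ → Plane)} [IsProbabilityMeasure Qu]

/-- The product formula holds for arbitrary sets, which spares measurability proofs for the events
below. -/
lemma netLaw_prod (S : Set (ℕ → Plane)) (T : Set ((ℕ → Plane) × (ℕ → unitInterval))) :
    netLaw Qb Qu {g | g.1 ∈ S ∧ g.2 ∈ T} = Qb S * (Qu.prod losLaw) T :=
  Measure.prod_prod S T

lemma netLaw_tbs_uav (S T : Set (ℕ → Plane)) :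
    netLaw Qb Qu {g | g.1 ∈ S ∧ g.2.1 ∈ T} = Qb S * Qu T := by
  have h : (Qu.prod losLaw) (T ×ˢ Set.univ) = Qu T * losLaw Set.univ := Measure.prod_prod T _
  rw [measure_univ, mul_one] at h
  rw [← h, ← netLaw_prod]
  simp

lemma netLaw_tbs (S : Set (ℕ → Plane)) : netLaw Qb Qu {g | g.1 ∈ S} = Qb S := by
  have h := netLaw_prod (Qb := Qb) (Qu := Qu) S Set.univ
  simpa using h

variable [IsProbabilityMeasure Qb]

instance : IsProbabilityMeasure (netLaw Qb Qu) := by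
  unfold netLaw
  infer_instance

lemma netLaw_snd (T : Set ((ℕ → Plane) × (ℕ → unitInterval))) :
    netLaw Qb Qu {g | g.2 ∈ T} = (Qu.prod losLaw) T := by
  have h := netLaw_prod (Qb := Qb) (Qu := Qu) Set.univ T
  simpa using h

lemma netLaw_uav (S : Set (ℕ → Plane)) : netLaw Qb Qu {g | g.2.1 ∈ S} = Qu S := by
  have h : (Qu.prod losLaw) (S ×ˢ Set.univ) = Qu S * losLaw Set.univ := Measure.prod_prod S _
  rw [measure_univ, mul_one] at h
  rw [← h, ← netLaw_snd (Qb := Qb)]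
  simp

end netLaw

namespace Params

variable (p : Params)

lemma dist_eq_link (g : Geometry) (j : Tx) : p.dist g j = p.link (p.tier g j) ‖proj g j‖ := by
  rcases j with i | i
  · rfl
  · simp only [link, tier]
    split_ifs <;> rfl

lemma rxPow_eq (s : Scenario) (g : Geometry) (j : Tx) :
    p.rxPow s g j = p.servPow s (p.tier g j) (p.link (p.tier g j) ‖proj g j‖) := by
  rw [rxPow, dist_eq_link]

lemma rxPow_pos (s : Scenario) (g : Geometry) (j : Tx) : 0 < p.rxPow s g j := by
  rw [rxPow_eq]
  exact p.servPow_pos s _ (p.link_pos _ _)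

lemma rxPow_le_alt (s : Scenario) (g : Geometry) (j : Tx) :
    p.rxPow s g j ≤ p.servPow s (p.tier g j) (p.alt (p.tier g j)) := by
  rw [rxPow_eq]
  exact p.servPow_anti s _ le_rfl (p.alt_le_link _ _)

lemma le_rxPow (s : Scenario) {g : Geometry} {j : Tx} {r : ℝ} (h : ‖proj g j‖ ≤ r) :
    p.servPow s (p.tier g j) (p.link (p.tier g j) r) ≤ p.rxPow s g j := by
  rw [rxPow_eq]
  exact p.servPow_anti s _ (p.alt_le_link _ _) (p.link_mono _ (norm_nonneg _) h)

lemma tier_uav_ne (g : Geometry) (i : ℕ) : p.tier g (Sum.inr i) ≠ Tier.b := by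
  simp only [tier]
  split_ifs <;> simp

/-- No UAV in the disc of radius `R` is in line of sight. -/
def noLoS (R : ℝ) : Set Geometry :=
  {g | ∀ i, g.2.1 i ∈ disc R → p.tier g (Sum.inr i) ≠ Tier.L}

lemma exists_of_notMem_noLoS {R : ℝ} {g : Geometry} (h : g ∉ p.noLoS R) :
    ∃ i, g.2.1 i ∈ disc R ∧ p.tier g (Sum.inr i) = Tier.L := by
  simpa [noLoS] using h

/-- Probability that no UAV in a disc is in line of sight. -/
lemma exists_noLoS_le : ∃ q : ℝ, 0 < q ∧ ∀ (Qb Qu : Measure (ℕ → Plane)) (lam : ℝ),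
    IsProbabilityMeasure Qb → 0 ≤ lam → IsPlanarPPP lam Qu → ∀ R, 0 ≤ R →
      netLaw Qb Qu (p.noLoS R) ≤ ENNReal.ofReal (Real.exp (-(q * (lam * (Real.pi * R ^ 2))))) := by
  obtain ⟨q₀, q₁, h0, h01, h1, hq⟩ := p.exists_pLoS_bounds
  refine ⟨q₀, h0, fun Qb Qu lam hQb hl hQu R hR => ?_⟩
  have := hQu.prob
  -- A mark at most `q₀` forces line of sight at any distance, so on `noLoS` all marks of the points
  -- in the disc exceed `q₀`.
  have hI : MeasurableSet {t : unitInterval | q₀ < (t : ℝ)} :=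
    measurableSet_lt measurable_const measurable_subtype_coe
  have hvol : (volume {t : unitInterval | q₀ < (t : ℝ)}).toReal = 1 - q₀ := by
    have : {t : unitInterval | q₀ < (t : ℝ)} = Set.Ioi ⟨q₀, h0.le, (h01.trans_lt h1).le⟩ := rfl
    rw [this, unitInterval.volume_Ioi, ENNReal.toReal_ofReal (by linarith)]
  have h := hQu.prob_marks_le (measurableSet_disc R) (intensity_disc_lt_top lam hR) hI
  rw [hvol, intensity_disc hl hR, sub_sub_cancel, ← netLaw_snd (Qb := Qb)] at h
  refine (measure_mono fun g hg => ?_).trans h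
  intro i hi
  by_contra hc
  refine hg i hi ?_
  simp only [tier]
  exact if_pos ((not_lt.1 hc).trans (hq _).1)

/-- Almost surely every disc contains finitely many transmitters. -/
lemma ae_locally_finite {Qb Qu : Measure (ℕ → Plane)} {lamb lamu : ℝ}
    (hQb : IsPlanarPPP lamb Qb) (hQu : IsPlanarPPP lamu Qu) :
    ∀ᵐ g ∂(netLaw Qb Qu), ∀ n : ℕ, {j | ‖proj g j‖ < n}.Finite := by
  have := hQb.prob
  have := hQu.prob
  rw [ae_all_iff]
  intro n
  have hn : (0 : ℝ) ≤ n := Nat.cast_nonneg n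
  have h1 := hQb.ae_exists_count (measurableSet_disc n) (intensity_disc_lt_top lamb hn)
  have h2 := hQu.ae_exists_count (measurableSet_disc n) (intensity_disc_lt_top lamu hn)
  have h1' : ∀ᵐ g ∂(netLaw Qb Qu), ∃ m : ℕ, pointCount g.1 (disc n) = m := by
    rw [ae_iff] at h1 ⊢
    rw [← h1]
    exact netLaw_tbs {x | ¬ ∃ m : ℕ, pointCount x (disc n) = m}
  have h2' : ∀ᵐ g ∂(netLaw Qb Qu), ∃ m : ℕ, pointCount g.2.1 (disc n) = m := by
    rw [ae_iff] at h2 ⊢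
    rw [← h2]
    exact netLaw_uav {x | ¬ ∃ m : ℕ, pointCount x (disc n) = m}
  filter_upwards [h1', h2'] with g ⟨m, hm⟩ ⟨m', hm'⟩
  obtain ⟨S, -, hS⟩ := exists_finset_of_pointCount_eq hm
  obtain ⟨S', -, hS'⟩ := exists_finset_of_pointCount_eq hm'
  refine ((S.disjSum S').finite_toSet).subset fun j hj => ?_
  rcases j with i | i
  · exact Finset.mem_coe.2 (Finset.inl_mem_disjSum.2 ((hS i).1 (mem_disc.2 hj)))
  · exact Finset.mem_coe.2 (Finset.inr_mem_disjSum.2 ((hS' i).1 (mem_disc.2 hj)))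

/-- Transmitters at least as strong as the TBS with index 0 lie in a bounded disc, hence are
finitely many, and the strongest of them serves. -/
lemma ae_exists_isServing (s : Scenario) {Qb Qu : Measure (ℕ → Plane)} {lamb lamu : ℝ}
    (hQb : IsPlanarPPP lamb Qb) (hQu : IsPlanarPPP lamu Qu) :
    ∀ᵐ g ∂(netLaw Qb Qu), ∃ j, p.IsServing s g j := by
  filter_upwards [ae_locally_finite hQb hQu] with g hg
  obtain ⟨ρ, -, hρ⟩ := p.exists_forall_servPow_lt s (p.rxPow_pos s g (Sum.inl 0))
  obtain ⟨n, hn⟩ := exists_nat_gt ρ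
  have hfin : {j | p.rxPow s g (Sum.inl 0) ≤ p.rxPow s g j}.Finite := by
    refine (hg n).subset fun j hj => ?_
    by_contra hc
    refine absurd (hρ (p.tier g j) (p.dist g j) ?_) (not_lt.2 hj)
    rw [dist_eq_link]
    exact (hn.le.trans (not_lt.1 hc)).trans (p.le_link _ _)
  obtain ⟨j, hj, hmax⟩ := Set.exists_max_image _ (p.rxPow s g) hfin ⟨Sum.inl 0, by simp⟩
  refine ⟨j, fun j' => ?_⟩
  by_cases h : p.rxPow s g (Sum.inl 0) ≤ p.rxPow s g j'
  · exact hmax j' h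
  · exact (not_le.1 h).le.trans hj

/-- Ties could make the three events overlap; only this inequality is needed, since upper bounds for
two tiers then give a lower bound for the third. -/
lemma one_le_sum_assocProb (s : Scenario) {Qb Qu : Measure (ℕ → Plane)} {lamb lamu : ℝ}
    (hQb : IsPlanarPPP lamb Qb) (hQu : IsPlanarPPP lamu Qu) :
    1 ≤ p.assocProb s Qb Qu Tier.b + p.assocProb s Qb Qu Tier.L + p.assocProb s Qb Qu Tier.N := by
  have := hQb.prob
  have := hQu.prob
  have h : (netLaw Qb Qu).real (p.assocEvent s Tier.b ∪ p.assocEvent s Tier.L ∪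
      p.assocEvent s Tier.N) = 1 := by
    rw [measureReal_def, measure_congr (t := Set.univ), measure_univ, ENNReal.toReal_one]
    rw [eventuallyEq_univ]
    filter_upwards [p.ae_exists_isServing s hQb hQu] with g ⟨j, hj⟩
    cases hk : p.tier g j
    · exact Or.inl (Or.inl ⟨j, hk, hj⟩)
    · exact Or.inl (Or.inr ⟨j, hk, hj⟩)
    · exact Or.inr ⟨j, hk, hj⟩
  rw [← h]
  exact (measureReal_union_le _ _).trans (add_le_add_left (measureReal_union_le _ _) _)

/-! ### Lower bounds of the association probabilities -/

lemma isServing_of_forall_norm (s : Scenario) {g : Geometry} {j : Tx} {ρ : ℝ}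
    (hj : ‖proj g j‖ < 1)
    (hρ : ∀ k r, ρ ≤ r → p.servPow s k r <
      p.servPow s (p.tier g j) (p.link (p.tier g j) 1))
    (h : ∀ j', j' ≠ j → ρ ≤ ‖proj g j'‖) : p.IsServing s g j := by
  intro j'
  by_cases hjj : j' = j
  · rw [hjj]
  · refine le_trans ?_ (p.le_rxPow s hj.le)
    rw [rxPow_eq]
    exact (hρ _ _ ((h j' hjj).trans (p.le_link _ _))).le

lemma exists_unique_of_count {x : ℕ → Plane} {ρ : ℝ} (h1 : pointCount x (disc 1) = 1)
    (h0 : pointCount x (disc ρ \ disc 1) = 0) :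
    ∃ i, x i ∈ disc 1 ∧ ∀ i', i' ≠ i → ρ ≤ ‖x i'‖ := by
  obtain ⟨S, hS, hi⟩ := exists_finset_of_pointCount_eq (n := 1) (by simpa using h1)
  obtain ⟨i, rfl⟩ := Finset.card_eq_one.1 hS
  refine ⟨i, by simp [hi], fun i' hne => ?_⟩
  have h2 := pointCount_eq_zero_iff.1 h0 i'
  by_contra hc
  exact h2 ⟨mem_disc.2 (not_le.1 hc), by simpa [hi] using hne⟩

lemma forall_le_norm_of_count {x : ℕ → Plane} {ρ : ℝ} (h0 : pointCount x (disc ρ) = 0) (i : ℕ) :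
    ρ ≤ ‖x i‖ := by
  have h2 := pointCount_eq_zero_iff.1 h0 i
  rwa [mem_disc, not_lt] at h2

lemma prob_none {Q : Measure (ℕ → Plane)} {lam ρ : ℝ} (hQ : IsPlanarPPP lam Q) (hl : 0 ≤ lam)
    (hρ : 0 ≤ ρ) : Q {x | pointCount x (disc ρ) = 0} =
      ENNReal.ofReal (Real.exp (-(lam * (Real.pi * ρ ^ 2)))) := by
  have h := hQ.prob_count (measurableSet_disc ρ) (intensity_disc_lt_top lam hρ) 0
  rw [intensity_disc hl hρ] at h
  simpa using h

lemma prob_single {Q : Measure (ℕ → Plane)} {lam ρ : ℝ} (hQ : IsPlanarPPP lam Q) (hl : 0 ≤ lam)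
    (hρ : 1 ≤ ρ) : Q {x | pointCount x (disc 1) = 1 ∧ pointCount x (disc ρ \ disc 1) = 0} =
      ENNReal.ofReal (lam * Real.pi * Real.exp (-(lam * (Real.pi * ρ ^ 2)))) := by
  have hρ0 : 0 ≤ ρ := zero_le_one.trans hρ
  rw [hQ.prob_one_and_none (measurableSet_disc 1)
    ((measurableSet_disc ρ).diff (measurableSet_disc 1)) Set.disjoint_sdiff_right
    (intensity_disc_lt_top lam zero_le_one) (intensity_shell_lt_top lam hρ0),
    intensity_disc hl zero_le_one, intensity_shell hl hρ, add_sub_cancel]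
  simp [mul_assoc]

lemma prob_single_marks {Q : Measure (ℕ → Plane)} {lam ρ : ℝ} (hQ : IsPlanarPPP lam Q)
    (hl : 0 ≤ lam) (hρ : 1 ≤ ρ) {I : Set unitInterval} (hI : MeasurableSet I) :
    (Q.prod losLaw) {y | (pointCount y.1 (disc 1) = 1 ∧ pointCount y.1 (disc ρ \ disc 1) = 0) ∧
        ∀ i, y.1 i ∈ disc 1 → y.2 i ∈ I} =
      volume I * ENNReal.ofReal (lam * Real.pi * Real.exp (-(lam * (Real.pi * ρ ^ 2)))) := by
  have hρ0 : 0 ≤ ρ := zero_le_one.trans hρ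
  rw [hQ.prob_one_marks (measurableSet_disc 1)
    ((measurableSet_disc ρ).diff (measurableSet_disc 1)) Set.disjoint_sdiff_right
    (intensity_disc_lt_top lam zero_le_one) (intensity_shell_lt_top lam hρ0) hI,
    intensity_disc hl zero_le_one, intensity_shell hl hρ, add_sub_cancel]
  simp [mul_assoc]

/-- The configuration used: no TBS within ρ, exactly one UAV in the unit disc with its mark in `I`,
and no further UAV within ρ. Its probability is a constant times λ_u·exp(-πρ²·λ_u). The factor `min
lamu 1` gives a common form with tier b, where the factor λ_u is absent. -/
lemma exists_le_assocProb_uav (s : Scenario) {Qb : Measure (ℕ → Plane)} {lamb : ℝ}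
    (hlamb : 0 < lamb) (hQb : IsPlanarPPP lamb Qb) (k : Tier) {I : Set unitInterval}
    (hI : MeasurableSet I) (hIpos : 0 < (volume I).toReal)
    (hIk : ∀ (g : Geometry) i, g.2.2 i ∈ I → p.tier g (Sum.inr i) = k) :
    ∃ c C : ℝ, 0 < c ∧ ∀ (lamu : ℝ) (Qu : Measure (ℕ → Plane)), 0 < lamu → IsPlanarPPP lamu Qu →
      c * min lamu 1 * Real.exp (-(C * lamu)) ≤ p.assocProb s Qb Qu k := by
  obtain ⟨ρ, hρ1, hρ⟩ := p.exists_forall_servPow_lt s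
    (p.servPow_pos s k (p.link_pos k 1))
  have hρ0 : 0 ≤ ρ := zero_le_one.trans hρ1
  refine ⟨Real.exp (-(lamb * (Real.pi * ρ ^ 2))) * ((volume I).toReal * Real.pi),
    Real.pi * ρ ^ 2, by positivity, fun lamu Qu hl hQu => ?_⟩
  have := hQb.prob
  have := hQu.prob
  have h := netLaw_prod (Qb := Qb) (Qu := Qu) {x | pointCount x (disc ρ) = 0}
    {y | (pointCount y.1 (disc 1) = 1 ∧ pointCount y.1 (disc ρ \ disc 1) = 0) ∧
        ∀ i, y.1 i ∈ disc 1 → y.2 i ∈ I}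
  rw [prob_none hQb hlamb.le hρ0, prob_single_marks hQu hl.le hρ1 hI] at h
  have h2 := congrArg ENNReal.toReal h
  rw [ENNReal.toReal_mul, ENNReal.toReal_mul, ENNReal.toReal_ofReal (by positivity),
    ENNReal.toReal_ofReal (by positivity)] at h2
  calc _ ≤ Real.exp (-(lamb * (Real.pi * ρ ^ 2))) * ((volume I).toReal * Real.pi) * lamu *
        Real.exp (-(Real.pi * ρ ^ 2 * lamu)) := by
        gcongr
        exact min_le_left _ _
    _ = _ := by rw [mul_comm (Real.pi * ρ ^ 2) lamu, ← mul_assoc, mul_assoc _ Real.pi lamu]; ring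
    _ = _ := h2.symm
    _ ≤ _ := by
        refine measureReal_mono ?_
        rintro g ⟨hb, ⟨h1, h0⟩, hm⟩
        obtain ⟨i, hi, hne⟩ := exists_unique_of_count h1 h0
        have hk := hIk g i (hm i hi)
        refine ⟨Sum.inr i, hk, p.isServing_of_forall_norm s (mem_disc.1 hi) (by rwa [hk]) ?_⟩
        rintro (i' | i') hi'
        · exact forall_le_norm_of_count hb i'
        · exact hne i' fun e => hi' (by rw [e])

/-- Association probabilities decay at most exponentially in the UAV density. -/
lemma exists_le_assocProb (s : Scenario) {Qb : Measure (ℕ → Plane)} {lamb : ℝ}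
    (hlamb : 0 < lamb) (hQb : IsPlanarPPP lamb Qb) (k : Tier) :
    ∃ c C : ℝ, 0 < c ∧ ∀ (lamu : ℝ) (Qu : Measure (ℕ → Plane)), 0 < lamu → IsPlanarPPP lamu Qu →
      c * min lamu 1 * Real.exp (-(C * lamu)) ≤ p.assocProb s Qb Qu k := by
  obtain ⟨q₀, q₁, h0, h01, h1, hq⟩ := p.exists_pLoS_bounds
  cases k
  -- The roles are exchanged: a single TBS in the unit disc, no other TBS and no UAV within ρ.
  · obtain ⟨ρ, hρ1, hρ⟩ := p.exists_forall_servPow_lt s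
      (p.servPow_pos s Tier.b (p.link_pos Tier.b 1))
    have hρ0 : 0 ≤ ρ := zero_le_one.trans hρ1
    refine ⟨lamb * Real.pi * Real.exp (-(lamb * (Real.pi * ρ ^ 2))),
      Real.pi * ρ ^ 2, by positivity, fun lamu Qu hl hQu => ?_⟩
    have := hQb.prob
    have := hQu.prob
    have h := netLaw_tbs_uav (Qb := Qb) (Qu := Qu)
      {x | pointCount x (disc 1) = 1 ∧ pointCount x (disc ρ \ disc 1) = 0}
      {x | pointCount x (disc ρ) = 0}
    rw [prob_none hQu hl.le hρ0, prob_single hQb hlamb.le hρ1] at h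
    have h2 := congrArg ENNReal.toReal h
    rw [ENNReal.toReal_mul, ENNReal.toReal_ofReal (by positivity),
      ENNReal.toReal_ofReal (by positivity)] at h2
    calc _ ≤ lamb * Real.pi * Real.exp (-(lamb * (Real.pi * ρ ^ 2))) * 1 *
          Real.exp (-(Real.pi * ρ ^ 2 * lamu)) := by
          gcongr
          exact min_le_right _ _
      _ = _ := by rw [mul_comm (Real.pi * ρ ^ 2) lamu, mul_one]
      _ = _ := h2.symm
      _ ≤ _ := by
          refine measureReal_mono ?_
          rintro g ⟨⟨h1, h0⟩, hu⟩
          obtain ⟨i, hi, hne⟩ := exists_unique_of_count h1 h0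
          refine ⟨Sum.inl i, rfl, p.isServing_of_forall_norm s (mem_disc.1 hi) hρ ?_⟩
          rintro (i' | i') hi'
          · exact hne i' fun e => hi' (by rw [e])
          · exact forall_le_norm_of_count hu i'
  · have e : {t : unitInterval | (t : ℝ) ≤ q₀} = Set.Iic ⟨q₀, h0.le, (h01.trans_lt h1).le⟩ := rfl
    refine p.exists_le_assocProb_uav s hlamb hQb Tier.L
      (measurableSet_le measurable_subtype_coe measurable_const : MeasurableSet
        {t : unitInterval | (t : ℝ) ≤ q₀}) ?_ fun g i hi => ?_
    · rw [e, unitInterval.volume_Iic, ENNReal.toReal_ofReal h0.le]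
      exact h0
    · simp only [tier]
      exact if_pos (le_trans hi (hq _).1)
  · have e : {t : unitInterval | q₁ < (t : ℝ)} = Set.Ioi ⟨q₁, (h0.trans_le h01).le, h1.le⟩ := rfl
    refine p.exists_le_assocProb_uav s hlamb hQb Tier.N
      (measurableSet_lt measurable_const measurable_subtype_coe : MeasurableSet
        {t : unitInterval | q₁ < (t : ℝ)}) ?_ fun g i hi => ?_
    · rw [e, unitInterval.volume_Ioi, ENNReal.toReal_ofReal (by simpa using h1.le)]
      simpa using h1
    · simp only [tier]
      exact if_neg (not_le.2 ((hq _).2.trans_lt hi))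

/-! ### Limits of the association probabilities -/

lemma servPow_le_of_isServing {s : Scenario} {g : Geometry} {j : Tx} (hj : p.IsServing s g j)
    {δ : ℝ} (hg : g ∉ p.noLoS δ) : p.servPow s Tier.L (p.link Tier.L δ) ≤ p.rxPow s g j := by
  obtain ⟨i, hi, hk⟩ := p.exists_of_notMem_noLoS hg
  have h := p.le_rxPow s (g := g) (j := Sum.inr i) (mem_disc.1 hi).le
  rw [hk] at h
  exact h.trans (hj _)

lemma tendsto_noLoS {Qb : Measure (ℕ → Plane)} {lamb : ℝ} (hQb : IsPlanarPPP lamb Qb)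
    {Qu : ℝ → Measure (ℕ → Plane)} (hQu : ∀ lamu : ℝ, 0 < lamu → IsPlanarPPP lamu (Qu lamu))
    {δ : ℝ} (hδ : 0 < δ) :
    Tendsto (fun lamu => (netLaw Qb (Qu lamu)).real (p.noLoS δ)) atTop (𝓝 0) := by
  obtain ⟨q, hq, h⟩ := p.exists_noLoS_le
  have ht : Tendsto (fun lamu : ℝ => Real.exp (-(q * (lamu * (Real.pi * δ ^ 2))))) atTop (𝓝 0) := by
    refine Real.tendsto_exp_neg_atTop_nhds_zero.comp ?_
    exact (tendsto_id.atTop_mul_const (by positivity)).const_mul_atTop hq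
  refine tendsto_of_tendsto_of_tendsto_of_le_of_le' tendsto_const_nhds ht
    (Eventually.of_forall fun _ => measureReal_nonneg) ?_
  filter_upwards [eventually_gt_atTop 0] with lamu hl
  exact ENNReal.toReal_le_of_le_ofReal (Real.exp_pos _).le
    (h Qb (Qu lamu) lamu hQb.prob hl.le (hQu lamu hl) δ hδ.le)

lemma servPow_alt_lt (s : Scenario)
    (hLN : p.kap Tier.N * p.Hu ^ (-(p.alp Tier.N)) < p.kap Tier.L * p.Hu ^ (-(p.alp Tier.L))) :
    p.servPow s Tier.N (p.alt Tier.N) < p.servPow s Tier.L (p.alt Tier.L) := by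
  rw [servPow_alt, servPow_alt, mul_assoc, mul_assoc]
  exact mul_lt_mul_of_pos_left hLN (p.maxGain_pos Tier.L)

/-- For small δ a line-of-sight UAV in the disc of radius δ is stronger than a non-line-of-sight UAV
even at the zenith, so association with N lies within `noLoS δ`. -/
lemma tendsto_assocProb_N (s : Scenario)
    (hLN : p.kap Tier.N * p.Hu ^ (-(p.alp Tier.N)) < p.kap Tier.L * p.Hu ^ (-(p.alp Tier.L)))
    {Qb : Measure (ℕ → Plane)} {lamb : ℝ} (hQb : IsPlanarPPP lamb Qb)
    {Qu : ℝ → Measure (ℕ → Plane)} (hQu : ∀ lamu : ℝ, 0 < lamu → IsPlanarPPP lamu (Qu lamu)) :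
    Tendsto (fun lamu => p.assocProb s Qb (Qu lamu) Tier.N) atTop (𝓝 0) := by
  obtain ⟨δ, hδ, h⟩ := p.exists_lt_servPow_link s Tier.L (p.servPow_alt_lt s hLN)
  refine tendsto_of_tendsto_of_tendsto_of_le_of_le' tendsto_const_nhds
    (p.tendsto_noLoS hQb hQu hδ) (Eventually.of_forall fun _ => measureReal_nonneg) ?_
  filter_upwards [eventually_gt_atTop 0] with lamu hl
  have := hQb.prob
  have := (hQu lamu hl).prob
  refine measureReal_mono ?_
  rintro g ⟨j, hk, hj⟩
  by_contra hg
  have h1 := p.rxPow_le_alt s g j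
  rw [hk] at h1
  exact absurd ((p.servPow_le_of_isServing hj hg).trans h1) (not_le.2 h)

/-- Horizontal radius within which a TBS beats every UAV. -/
def tbsRadius (s : Scenario) : ℝ := √(p.chi s Tier.L Tier.b p.Hu ^ 2 - p.Hb ^ 2)

lemma tbsRadius_nonneg (s : Scenario) : 0 ≤ p.tbsRadius s := Real.sqrt_nonneg _

lemma tbsRadius_sq (s : Scenario) :
    p.tbsRadius s ^ 2 = p.chi s Tier.L Tier.b p.Hu ^ 2 - p.Hb ^ 2 := by
  have h : p.Hb ≤ p.chi s Tier.L Tier.b p.Hu := p.alt_le_chi s Tier.L Tier.b p.Hu_pos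
  have := p.Hb_pos
  exact Real.sq_sqrt (by nlinarith)

lemma link_tbsRadius (s : Scenario) :
    p.link Tier.b (p.tbsRadius s) = p.chi s Tier.L Tier.b p.Hu := by
  have h : p.Hb ≤ p.chi s Tier.L Tier.b p.Hu := p.alt_le_chi s Tier.L Tier.b p.Hu_pos
  have := p.Hb_pos
  simp only [link, tbsRadius_sq, alt, sub_add_cancel]
  exact Real.sqrt_sq (by linarith)

lemma link_strictMono (k : Tier) {x y : ℝ} (hx : 0 ≤ x) (h : x < y) : p.link k x < p.link k y :=
  Real.sqrt_lt_sqrt (by positivity) (by gcongr)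

/-- A TBS inside `tbsRadius` is stronger than a line-of-sight UAV at the zenith, so the disc must be
empty of TBSs. The bound is not asymptotic: it holds for every UAV density. -/
lemma assocProb_L_le (s : Scenario) {Qb Qu : Measure (ℕ → Plane)} {lamb lamu : ℝ}
    (hlamb : 0 < lamb) (hQb : IsPlanarPPP lamb Qb) (hQu : IsPlanarPPP lamu Qu) :
    p.assocProb s Qb Qu Tier.L ≤ Real.exp (-(lamb * (Real.pi * p.tbsRadius s ^ 2))) := by
  have := hQb.prob
  have := hQu.prob
  have h := netLaw_tbs (Qb := Qb) (Qu := Qu) {x | pointCount x (disc (p.tbsRadius s)) = 0}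
  rw [prob_none hQb hlamb.le (p.tbsRadius_nonneg s)] at h
  refine ENNReal.toReal_le_of_le_ofReal (Real.exp_pos _).le ?_
  rw [← h]
  refine measure_mono ?_
  rintro g ⟨j, hk, hj⟩
  refine pointCount_eq_zero_iff.2 fun i hi => ?_
  have h1 := p.rxPow_le_alt s g j
  rw [hk] at h1
  have h2 : p.link Tier.b ‖g.1 i‖ < p.chi s Tier.L Tier.b p.Hu := by
    rw [← link_tbsRadius]
    exact p.link_strictMono _ (norm_nonneg _) (mem_disc.1 hi)
  have h3 := p.lt_servPow_of_lt_chi (p.alt_le_link Tier.b _) h2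
  have h4 := hj (Sum.inl i)
  rw [rxPow_eq p s g (Sum.inl i)] at h4
  exact absurd (h4.trans h1) (not_le.2 h3)

/-- With r slightly larger than `tbsRadius`, a TBS beyond r is strictly weaker than a line-of-sight
UAV close enough to the zenith. Hence a serving TBS requires either a TBS within r or `noLoS δ`,
where δ depends only on `a` and the parameters, not on the UAV density. -/
lemma exists_assocProb_b_le (s : Scenario) {lamb a : ℝ} (hlamb : 0 < lamb)
    (ha : a < Real.exp (-(lamb * (Real.pi * p.tbsRadius s ^ 2)))) :
    ∃ δ : ℝ, 0 < δ ∧ ∀ (Qb Qu : Measure (ℕ → Plane)) (lamu : ℝ), IsPlanarPPP lamb Qb →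
      IsPlanarPPP lamu Qu →
      p.assocProb s Qb Qu Tier.b ≤ 1 - a + (netLaw Qb Qu).real (p.noLoS δ) := by
  have hr0 : 0 ≤ p.tbsRadius s := p.tbsRadius_nonneg s
  obtain ⟨r, hra, hr⟩ : ∃ r, a < Real.exp (-(lamb * (Real.pi * r ^ 2))) ∧ p.tbsRadius s < r := by
    have hc : Continuous fun r : ℝ => Real.exp (-(lamb * (Real.pi * r ^ 2))) := by fun_prop
    have h2 : ∀ᶠ r in 𝓝[>] p.tbsRadius s, a < Real.exp (-(lamb * (Real.pi * r ^ 2))) ∧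
        p.tbsRadius s < r :=
      ((hc.continuousAt.eventually_const_lt ha).filter_mono nhdsWithin_le_nhds).and
        self_mem_nhdsWithin
    exact h2.exists
  have hchi : p.chi s Tier.L Tier.b p.Hu < p.link Tier.b r := by
    rw [← link_tbsRadius]
    exact p.link_strictMono _ hr0 hr
  obtain ⟨δ, hδ, h⟩ := p.exists_lt_servPow_link s Tier.L (p.servPow_lt_of_chi_lt p.Hu_pos hchi)
  refine ⟨δ, hδ, fun Qb Qu lamu hQb hQu => ?_⟩
  have := hQb.prob
  have := hQu.prob
  have hr1 : 0 ≤ r := hr0.trans hr.le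
  have h0 := netLaw_tbs (Qb := Qb) (Qu := Qu) {x | pointCount x (disc r) = 0}ᶜ
  have hm : MeasurableSet {x : ℕ → Plane | pointCount x (disc r) = 0} :=
    measurable_pointCount (measurableSet_disc r) (measurableSet_singleton 0)
  rw [prob_compl_eq_one_sub hm, prob_none hQb hlamb.le hr1] at h0
  have h1 : (netLaw Qb Qu).real {g | g.1 ∈ {x | pointCount x (disc r) = 0}ᶜ} =
      1 - Real.exp (-(lamb * (Real.pi * r ^ 2))) := by
    rw [measureReal_def, h0, ENNReal.toReal_sub_of_le _ ENNReal.one_ne_top,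
      ENNReal.toReal_ofReal (Real.exp_pos _).le, ENNReal.toReal_one]
    rw [ENNReal.ofReal_le_one, Real.exp_le_one_iff]
    have : 0 ≤ lamb * (Real.pi * r ^ 2) := by positivity
    linarith
  calc p.assocProb s Qb Qu Tier.b
      ≤ (netLaw Qb Qu).real ({g | g.1 ∈ {x | pointCount x (disc r) = 0}ᶜ} ∪ p.noLoS δ) := by
        refine measureReal_mono ?_
        rintro g ⟨j, hk, hj⟩
        by_contra hg
        rw [Set.mem_union, not_or] at hg
        obtain ⟨hg1, hg2⟩ := hg
        have hg3 : pointCount g.1 (disc r) = 0 := by simpa using hg1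
        have h3 := p.servPow_le_of_isServing hj hg2
        rcases j with i | i
        · have h4 : p.rxPow s g (Sum.inl i) ≤ p.servPow s Tier.b (p.link Tier.b r) := by
            rw [rxPow_eq]
            exact p.servPow_anti s Tier.b (p.alt_le_link _ _)
              (p.link_mono _ hr1 (forall_le_norm_of_count hg3 i))
          exact absurd (h3.trans h4) (not_le.2 h)
        · exact p.tier_uav_ne g i hk
    _ ≤ _ := measureReal_union_le _ _
    _ ≤ _ := by
        rw [h1]
        linarith

lemma tendsto_assocProb_b (s : Scenario)
    (hLN : p.kap Tier.N * p.Hu ^ (-(p.alp Tier.N)) < p.kap Tier.L * p.Hu ^ (-(p.alp Tier.L)))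
    {Qb : Measure (ℕ → Plane)} {lamb : ℝ} (hlamb : 0 < lamb) (hQb : IsPlanarPPP lamb Qb)
    {Qu : ℝ → Measure (ℕ → Plane)} (hQu : ∀ lamu : ℝ, 0 < lamu → IsPlanarPPP lamu (Qu lamu)) :
    Tendsto (fun lamu => p.assocProb s Qb (Qu lamu) Tier.b) atTop
      (𝓝 (1 - Real.exp (-(lamb * (Real.pi * p.tbsRadius s ^ 2))))) := by
  refine tendsto_order.2 ⟨fun a ha => ?_, fun a ha => ?_⟩
  · have hN := (p.tendsto_assocProb_N s hLN hQb hQu).eventually_lt_const (sub_pos.2 ha)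
    filter_upwards [hN, eventually_gt_atTop 0] with lamu h1 hl
    have h2 := p.one_le_sum_assocProb s hQb (hQu lamu hl)
    have h3 := p.assocProb_L_le s hlamb hQb (hQu lamu hl)
    linarith
  · obtain ⟨b, hb, hba⟩ := exists_between ha
    obtain ⟨δ, hδ, h⟩ := p.exists_assocProb_b_le s hlamb (a := 1 - b) (by linarith)
    filter_upwards [(p.tendsto_noLoS hQb hQu hδ).eventually_lt_const (sub_pos.2 hba),
      eventually_gt_atTop 0] with lamu h1 hl
    have h2 := h Qb (Qu lamu) lamu hQb (hQu lamu hl)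
    linarith

lemma tendsto_assocProb_L (s : Scenario)
    (hLN : p.kap Tier.N * p.Hu ^ (-(p.alp Tier.N)) < p.kap Tier.L * p.Hu ^ (-(p.alp Tier.L)))
    {Qb : Measure (ℕ → Plane)} {lamb : ℝ} (hlamb : 0 < lamb) (hQb : IsPlanarPPP lamb Qb)
    {Qu : ℝ → Measure (ℕ → Plane)} (hQu : ∀ lamu : ℝ, 0 < lamu → IsPlanarPPP lamu (Qu lamu)) :
    Tendsto (fun lamu => p.assocProb s Qb (Qu lamu) Tier.L) atTop
      (𝓝 (Real.exp (-(lamb * (Real.pi * p.tbsRadius s ^ 2))))) := by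
  have hb := p.tendsto_assocProb_b s hLN hlamb hQb hQu
  have hN := p.tendsto_assocProb_N s hLN hQb hQu
  refine tendsto_of_tendsto_of_tendsto_of_le_of_le' (g := fun lamu =>
    1 - p.assocProb s Qb (Qu lamu) Tier.b - p.assocProb s Qb (Qu lamu) Tier.N) ?_
    tendsto_const_nhds ?_ ?_
  · simpa using (hb.const_sub 1).sub hN
  · filter_upwards [eventually_gt_atTop 0] with lamu hl
    have h2 := p.one_le_sum_assocProb s hQb (hQu lamu hl)
    linarith
  · filter_upwards [eventually_gt_atTop 0] with lamu hl
    exact p.assocProb_L_le s hlamb hQb (hQu lamu hl)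

lemma tbsRadius_eq_zero (s : Scenario)
    (h : p.Pb * p.GMb * p.kap Tier.b * p.Hb ^ (-(p.alp Tier.b)) ≤
      p.Pu * p.GMu * p.kap Tier.L * p.Hu ^ (-(p.alp Tier.L))) : p.tbsRadius s = 0 := by
  have h1 : p.chi s Tier.L Tier.b p.Hu = p.alt Tier.b := by
    refine p.chi_eq_alt ?_
    have e := p.servPow_alt s Tier.L
    rw [servPow_alt]
    exact h.trans_eq e.symm
  simp [tbsRadius, h1, alt]

end Params

/-! ### Exponential moments of the fading gains -/

/-- Exponential tilting turns the Gamma density of rate r into a multiple of the one of rate r - t.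
-/
lemma lintegral_exp_gammaMeasure {a r t : ℝ} (ha : 0 < a) (hr : 0 < r) (ht : t < r) :
    ∫⁻ x, ENNReal.ofReal (Real.exp (t * x)) ∂(gammaMeasure a r) =
      ENNReal.ofReal ((r / (r - t)) ^ a) := by
  have hrt : 0 < r - t := sub_pos.2 ht
  have hm : ∀ a r : ℝ, Measurable (gammaPDF a r) := fun a r =>
    (measurable_gammaPDFReal a r).ennreal_ofReal
  rw [gammaMeasure, lintegral_withDensity_eq_lintegral_mul _ (hm a r) (by fun_prop)]
  have e : ∀ x, (gammaPDF a r * fun x => ENNReal.ofReal (Real.exp (t * x))) x =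
      ENNReal.ofReal ((r / (r - t)) ^ a) * gammaPDF a (r - t) x := by
    intro x
    simp only [Pi.mul_apply]
    rcases lt_or_ge x 0 with hx | hx
    · simp [gammaPDF_of_neg hx]
    · have hG := Real.Gamma_pos_of_pos ha
      rw [gammaPDF_of_nonneg hx, gammaPDF_of_nonneg hx, ← ENNReal.ofReal_mul (by positivity),
        ← ENNReal.ofReal_mul (by positivity), Real.div_rpow hr.le hrt.le]
      congr 1
      have h2 : Real.exp (-((r - t) * x)) = Real.exp (-(r * x)) * Real.exp (t * x) := by
        rw [← Real.exp_add]
        congr 1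
        ring
      have h3 : 0 < (r - t) ^ a := by positivity
      rw [h2]
      field_simp
  simp_rw [e]
  rw [lintegral_const_mul _ (hm _ _), lintegral_gammaPDF_eq_one ha hrt, mul_one]

lemma ae_nonneg_gammaMeasure (a r : ℝ) : ∀ᵐ x ∂(gammaMeasure a r), 0 ≤ x := by
  have h : gammaMeasure a r (Set.Iio 0) = 0 := by
    rw [gammaMeasure, withDensity_apply _ measurableSet_Iio, lintegral_gammaPDF_of_nonpos le_rfl]
  rw [ae_iff]
  convert h using 2
  ext x
  simp

instance : Finite Tier := by
  refine Finite.of_surjective (fun i : Fin 3 => ![Tier.b, Tier.L, Tier.N] i) fun k => ?_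
  cases k
  exacts [⟨0, rfl⟩, ⟨1, rfl⟩, ⟨2, rfl⟩]

instance : Nonempty Tier := ⟨Tier.b⟩

namespace Params

variable (p : Params)

/-- Law of the fading gains. -/
abbrev fadeLaw : Measure (Tier × ℕ → ℝ) :=
  Measure.infinitePi fun ki : Tier × ℕ => gammaMeasure (p.fad ki.1) (p.fad ki.1)

instance (ki : Tier × ℕ) : IsProbabilityMeasure (gammaMeasure (p.fad ki.1) (p.fad ki.1)) :=
  isProbabilityMeasure_gammaMeasure (p.fad_pos _) (p.fad_pos _)

instance : IsProbabilityMeasure p.markLaw := by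
  unfold markLaw
  infer_instance

lemma ae_nonneg_fadeLaw : ∀ᵐ h ∂p.fadeLaw, ∀ ki, 0 ≤ h ki := by
  rw [ae_all_iff]
  intro ki
  have := measurePreserving_eval_infinitePi
    (fun ki : Tier × ℕ => gammaMeasure (p.fad ki.1) (p.fad ki.1)) ki
  exact this.quasiMeasurePreserving.ae (ae_nonneg_gammaMeasure _ _)

/-- Index of the fading gain of a transmitter. -/
def fadeKey (g : Geometry) (j : Tx) : Tier × ℕ := (p.tier g j, idx j)

/-- No UAV has tier b, so a TBS and a UAV of equal index use different gains. This makes the fading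
gains of distinct transmitters independent. -/
lemma fadeKey_injective (g : Geometry) : Function.Injective (p.fadeKey g) := by
  rintro (i | i) (j | j) h
  · rw [show i = j from congrArg Prod.snd h]
  · exact absurd (congrArg Prod.fst h).symm (p.tier_uav_ne g j)
  · exact absurd (congrArg Prod.fst h) (p.tier_uav_ne g i)
  · rw [show i = j from congrArg Prod.snd h]

lemma lintegral_prod_exp_fading (g : Geometry) (T : Finset Tx) (w : Tx → ℝ)
    (hw : ∀ j ∈ T, w j < p.fad (p.tier g j)) :
    ∫⁻ h, ∏ j ∈ T, ENNReal.ofReal (Real.exp (w j * h (p.fadeKey g j))) ∂p.fadeLaw =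
      ∏ j ∈ T, ENNReal.ofReal ((p.fad (p.tier g j) / (p.fad (p.tier g j) - w j)) ^
        (p.fad (p.tier g j))) := by
  have hi : iIndepFun (fun (ki : Tier × ℕ) (h : Tier × ℕ → ℝ) => h ki) p.fadeLaw :=
    iIndepFun_infinitePi (X := fun _ x => x) fun _ => measurable_id
  have hi2 := (hi.precomp (p.fadeKey_injective g)).comp
    (fun j x => ENNReal.ofReal (Real.exp (w j * x))) (fun j => by fun_prop)
  have h := lintegral_prod_eq_prod_lintegral_of_indepFun T _ hi2 (fun j => by
    simp only [Function.comp_def]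
    fun_prop)
  refine h.trans (Finset.prod_congr rfl fun j hj => ?_)
  have hmp := measurePreserving_eval_infinitePi
    (fun ki : Tier × ℕ => gammaMeasure (p.fad ki.1) (p.fad ki.1)) (p.fadeKey g j)
  have h2 := hmp.lintegral_comp (f := fun x => ENNReal.ofReal (Real.exp (w j * x)))
    (by fun_prop)
  exact h2.trans (lintegral_exp_gammaMeasure (p.fad_pos _) (p.fad_pos _) (hw j hj))

/-- One fading gain rarely dominates a weighted sum of many others. -/
lemma exists_fading_tail {β : ℝ} (hβ : 0 < β) : ∃ C ρ : ℝ, 0 < C ∧ 0 < ρ ∧ ρ < 1 ∧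
    ∀ (g : Geometry) (j : Tx) (S : Finset Tx), j ∉ S →
      p.fadeLaw {h | β * ∑ i ∈ S, h (p.fadeKey g i) ≤ h (p.fadeKey g j)} ≤
        ENNReal.ofReal (C * ρ ^ S.card) := by
  classical
  obtain ⟨k₀, hk₀⟩ := Finite.exists_min p.fad
  have hθ := p.fad_pos k₀
  -- Half the smallest rate keeps the exponential moment at θ finite for every tier.
  set θ := p.fad k₀ / 2 with hθdef
  have hθ0 : 0 < θ := by positivity
  have hθk : ∀ k, θ < p.fad k := fun k => by linarith [hk₀ k]
  -- The largest moment E[exp(θH)] over the tiers becomes the constant C, and the largest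
  -- E[exp(-θβH)], which is below 1, becomes the ratio ρ.
  obtain ⟨k₁, hk₁⟩ := Finite.exists_max fun k => (p.fad k / (p.fad k - θ)) ^ p.fad k
  obtain ⟨k₂, hk₂⟩ := Finite.exists_max fun k => (p.fad k / (p.fad k - -(θ * β))) ^ p.fad k
  have hpos : ∀ k, 0 < p.fad k - -(θ * β) := fun k => by
    have := p.fad_pos k
    rw [sub_neg_eq_add]
    positivity
  refine ⟨(p.fad k₁ / (p.fad k₁ - θ)) ^ p.fad k₁,
    (p.fad k₂ / (p.fad k₂ - -(θ * β))) ^ p.fad k₂, ?_, ?_, ?_, fun g j S hj => ?_⟩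
  · exact Real.rpow_pos_of_pos (div_pos (p.fad_pos _) (sub_pos.2 (hθk _))) _
  · exact Real.rpow_pos_of_pos (div_pos (p.fad_pos _) (hpos _)) _
  · refine Real.rpow_lt_one (div_pos (p.fad_pos _) (hpos _)).le ?_ (p.fad_pos _)
    rw [div_lt_one (hpos _)]
    have : 0 < θ * β := by positivity
    linarith
  set w : Tx → ℝ := fun i => if i = j then θ else -(θ * β) with hw
  have hwS : ∀ i ∈ S, w i = -(θ * β) := fun i hi => if_neg (ne_of_mem_of_not_mem hi hj)
  have hwj : w j = θ := if_pos rfl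
  have hI := p.lintegral_prod_exp_fading g (insert j S) w (fun i _ => by
    simp only [hw]
    split_ifs
    · exact hθk _
    · have := hpos (p.tier g i)
      linarith)
  -- On the event, exp(θ·(H_j - β·∑ H_i)) ≥ 1; Markov's inequality and independence finish the
  -- Chernoff bound.
  have hsub : {h : Tier × ℕ → ℝ | β * ∑ i ∈ S, h (p.fadeKey g i) ≤ h (p.fadeKey g j)} ⊆
      {h | 1 ≤ ∏ i ∈ insert j S, ENNReal.ofReal (Real.exp (w i * h (p.fadeKey g i)))} := by
    intro h hh
    have hh' : β * ∑ i ∈ S, h (p.fadeKey g i) ≤ h (p.fadeKey g j) := hh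
    change 1 ≤ ∏ i ∈ insert j S, ENNReal.ofReal (Real.exp (w i * h (p.fadeKey g i)))
    rw [← ENNReal.ofReal_prod_of_nonneg fun _ _ => (Real.exp_pos _).le, ← Real.exp_sum,
      ENNReal.one_le_ofReal, Real.one_le_exp_iff, Finset.sum_insert hj, hwj,
      Finset.sum_congr rfl fun i hi => by rw [hwS i hi], ← Finset.mul_sum]
    nlinarith
  refine (measure_mono hsub).trans ?_
  have hM := mul_meas_ge_le_lintegral (μ := p.fadeLaw)
    (f := fun h => ∏ i ∈ insert j S, ENNReal.ofReal (Real.exp (w i * h (p.fadeKey g i))))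
    (Finset.measurable_fun_prod _ fun i _ => by fun_prop) 1
  rw [one_mul, hI] at hM
  refine hM.trans ?_
  rw [Finset.prod_insert hj, hwj, ENNReal.ofReal_mul (Real.rpow_pos_of_pos (div_pos (p.fad_pos _)
    (sub_pos.2 (hθk _))) _).le]
  refine mul_le_mul' (ENNReal.ofReal_le_ofReal (hk₁ _)) ?_
  rw [ENNReal.ofReal_pow (Real.rpow_pos_of_pos (div_pos (p.fad_pos _) (hpos _)) _).le]
  refine Finset.prod_le_pow_card _ _ _ fun i hi => ?_
  rw [hwS i hi]
  exact ENNReal.ofReal_le_ofReal (hk₂ _)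

/-! ### The conditional success probability -/

/-- Lower bound of the average power received from an interfering UAV. -/
lemma exists_le_interference_term (R : ℝ) : ∃ c : ℝ, 0 < c ∧
    ∀ (s : Scenario) (Qb Qu : Measure (ℕ → Plane)) (g : Geometry) (m : Marks) (i : ℕ),
      g.2.1 i ∈ disc R → 0 ≤ p.fading g m (Sum.inr i) →
      c * p.fading g m (Sum.inr i) ≤
        p.interfGain s Qb Qu g m (Sum.inr i) * p.fading g m (Sum.inr i) *
          p.kap (p.tier g (Sum.inr i)) *
          p.dist g (Sum.inr i) ^ (-(p.alp (p.tier g (Sum.inr i)))) := by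
  obtain ⟨k₀, hk₀⟩ := Finite.exists_min fun k => p.kap k * p.link k R ^ (-(p.alp k))
  have h1 := p.kap_pos k₀
  have h2 := p.link_pos k₀ R
  have h3 := p.Pu_pos
  have h4 := p.GMu_pos
  refine ⟨p.Pu * (p.GMu * (10 : ℝ) ^ (-p.sla)) * (p.kap k₀ * p.link k₀ R ^ (-(p.alp k₀))),
    by positivity, fun s Qb Qu g m i hi hf => ?_⟩
  set k := p.tier g (Sum.inr i) with hk
  have hd : p.link k R ^ (-(p.alp k)) ≤ p.dist g (Sum.inr i) ^ (-(p.alp k)) := by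
    rw [dist_eq_link, ← hk]
    exact Real.rpow_le_rpow_of_nonpos (p.link_pos _ _)
      (p.link_mono _ (norm_nonneg _) (mem_disc.1 hi).le) (neg_nonpos.2 (p.alp_pos k).le)
  have hg : p.Pu * (p.GMu * (10 : ℝ) ^ (-p.sla)) ≤ p.interfGain s Qb Qu g m (Sum.inr i) :=
    mul_le_mul_of_nonneg_left (le_gain p.GMu_pos) h3.le
  have hq : p.kap k₀ * p.link k₀ R ^ (-(p.alp k₀)) ≤
      p.kap k * p.dist g (Sum.inr i) ^ (-(p.alp k)) :=
    (hk₀ k).trans (mul_le_mul_of_nonneg_left hd (p.kap_pos k).le)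
  have hmul := mul_le_mul hg hq (by positivity) ((by positivity : (0 : ℝ) ≤
    p.Pu * (p.GMu * (10 : ℝ) ^ (-p.sla))).trans hg)
  calc _ ≤ p.interfGain s Qb Qu g m (Sum.inr i) *
        (p.kap k * p.dist g (Sum.inr i) ^ (-(p.alp k))) * p.fading g m (Sum.inr i) :=
        mul_le_mul_of_nonneg_right hmul hf
    _ = _ := by ring

lemma exists_rxPow_le (s : Scenario) : ∃ P : ℝ, 0 < P ∧ ∀ g j, p.rxPow s g j ≤ P := by
  obtain ⟨k₀, hk₀⟩ := Finite.exists_max fun k => p.servPow s k (p.alt k)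
  exact ⟨_, p.servPow_pos s k₀ (p.alt_pos k₀), fun g j => (p.rxPow_le_alt s g j).trans (hk₀ _)⟩

/-- The noise and all interferers outside `S` are dropped and the serving power is replaced by its
bound `P`. What remains compares one fading gain with a sum of others, the event of
`exists_fading_tail`. -/
lemma sinr_event_subset {s : Scenario} {Qb Qu : Measure (ℕ → Plane)} {g : Geometry} {j : Tx}
    {γ c P : ℝ} (hγ : 0 < γ) (hc : 0 < c) (hP : 0 < P) (hrx : p.rxPow s g j ≤ P)
    {S : Finset ℕ} (hS : ∀ i ∈ S, Sum.inr i ≠ j) {m : Marks} (hm : ∀ ki, 0 ≤ m.1 ki)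
    (hterm : ∀ i ∈ S, c * p.fading g m (Sum.inr i) ≤
        p.interfGain s Qb Qu g m (Sum.inr i) * p.fading g m (Sum.inr i) *
          p.kap (p.tier g (Sum.inr i)) *
          p.dist g (Sum.inr i) ^ (-(p.alp (p.tier g (Sum.inr i)))))
    (h : ENNReal.ofReal γ < p.sinr s Qb Qu g m j) :
    γ * c / P * ∑ i ∈ S.map Function.Embedding.inr, m.1 (p.fadeKey g i) ≤ m.1 (p.fadeKey g j) := by
  classical
  have hf : ∀ j, 0 ≤ p.fading g m j := fun j => hm _
  have hI : ENNReal.ofReal (∑ i ∈ S, c * p.fading g m (Sum.inr i)) ≤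
      p.interference s Qb Qu g m j := by
    rw [ENNReal.ofReal_sum_of_nonneg fun i _ => mul_nonneg hc.le (hf _)]
    unfold interference
    refine le_trans ?_ (ENNReal.sum_le_tsum (S.map Function.Embedding.inr))
    rw [Finset.sum_map]
    refine Finset.sum_le_sum fun i hi => ?_
    rw [Function.Embedding.inr_apply, if_neg (hS i hi)]
    exact ENNReal.ofReal_le_ofReal (hterm i hi)
  have h1 := ENNReal.mul_lt_of_lt_div h
  have h2 : ENNReal.ofReal (γ * ∑ i ∈ S, c * p.fading g m (Sum.inr i)) ≤
      ENNReal.ofReal (p.rxPow s g j * p.fading g m j) := by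
    rw [ENNReal.ofReal_mul hγ.le]
    exact (mul_le_mul' le_rfl (hI.trans le_add_self)).trans h1.le
  rw [ENNReal.ofReal_le_ofReal_iff (mul_nonneg (p.rxPow_pos s g j).le (hf j))] at h2
  have h3 := h2.trans (mul_le_mul_of_nonneg_right hrx (hf j))
  rw [← Finset.mul_sum] at h3
  rw [Finset.sum_map, div_mul_eq_mul_div, div_le_iff₀ hP, mul_comm _ P, mul_assoc]
  exact h3

open Classical in
/-- The conditional success probability decays exponentially in the number of UAVs nearby. -/
lemma exists_csp_le (s : Scenario) {γ : ℝ} (hγ : 0 < γ) (R : ℝ) :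
    ∃ C ρ : ℝ, 0 < C ∧ 0 < ρ ∧ ρ < 1 ∧
    ∀ (Qb Qu : Measure (ℕ → Plane)) (g : Geometry) (n : ℕ), pointCount g.2.1 (disc R) = n →
      p.csp s Qb Qu γ g ≤ (∑' j, if p.IsServing s g j then 1 else 0) *
        ENNReal.ofReal (C * ρ ^ n) := by
  obtain ⟨c, hc, hterm⟩ := p.exists_le_interference_term R
  obtain ⟨P, hP, hrx⟩ := p.exists_rxPow_le s
  obtain ⟨C, ρ, hC, hρ0, hρ1, htail⟩ := p.exists_fading_tail
    (show 0 < γ * c / P by positivity)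
  -- The server may be one of the n UAVs in the disc and does not interfere with itself, so only n -
  -- 1 interferers are guaranteed; the factor `ρ⁻¹` pays for the lost one.
  refine ⟨C * ρ⁻¹, ρ, by positivity, hρ0, hρ1, fun Qb Qu g n hn => ?_⟩
  obtain ⟨S, hcard, hS⟩ := exists_finset_of_pointCount_eq hn
  have key : ∀ j, p.markLaw {m | ENNReal.ofReal γ < p.sinr s Qb Qu g m j} ≤
      ENNReal.ofReal (C * ρ⁻¹ * ρ ^ n) := by
    intro j
    set S' := S.filter fun i => Sum.inr i ≠ j with hS'
    have hn1 : n ≤ S'.card + 1 := by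
      have h1 : S ⊆ insert (idx j) S' := by
        intro i hi
        by_cases hij : Sum.inr i = j
        · rw [← hij]
          exact Finset.mem_insert_self _ _
        · exact Finset.mem_insert_of_mem (Finset.mem_filter.2 ⟨hi, hij⟩)
      rw [← hcard]
      exact (Finset.card_le_card h1).trans (Finset.card_insert_le _ _)
    have hj : j ∉ S'.map Function.Embedding.inr := by
      intro hc
      obtain ⟨i, hi, hij⟩ := Finset.mem_map.1 hc
      exact (Finset.mem_filter.1 hi).2 hij
    have h0 : p.fadeLaw {h | ¬ ∀ ki, 0 ≤ h ki} = 0 := p.ae_nonneg_fadeLaw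
    have hprod : ∀ A : Set (Tier × ℕ → ℝ), p.markLaw {m | m.1 ∈ A} = p.fadeLaw A := by
      intro A
      have h := Measure.prod_prod (μ := p.fadeLaw)
        (ν := Measure.infinitePi fun _ : ℕ => (volume : Measure (unitInterval × unitInterval)))
        A Set.univ
      rw [measure_univ, mul_one] at h
      rw [← h]
      unfold markLaw
      congr 1
      ext m
      simp
    calc p.markLaw {m | ENNReal.ofReal γ < p.sinr s Qb Qu g m j}
        ≤ p.markLaw {m | m.1 ∈ {h | ¬ ∀ ki, 0 ≤ h ki} ∪ {h : Tier × ℕ → ℝ |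
            γ * c / P * ∑ i ∈ S'.map Function.Embedding.inr, h (p.fadeKey g i) ≤
              h (p.fadeKey g j)}} := by
          refine measure_mono fun m hm => ?_
          by_cases hnn : ∀ ki, 0 ≤ m.1 ki
          · refine Or.inr (p.sinr_event_subset hγ hc hP (hrx g j)
              (fun i hi => (Finset.mem_filter.1 hi).2) hnn (fun i hi => ?_) hm)
            exact hterm s Qb Qu g m i ((hS i).2 (Finset.mem_filter.1 hi).1) (hnn _)
          · exact Or.inl hnn
      _ = _ := hprod _
      _ ≤ 0 + ENNReal.ofReal (C * ρ ^ (S'.map (Function.Embedding.inr (α := ℕ))).card) := by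
          refine (measure_union_le _ _).trans ?_
          rw [h0]
          exact add_le_add_right (htail g j _ hj) 0
      _ ≤ _ := by
          rw [zero_add, Finset.card_map]
          refine ENNReal.ofReal_le_ofReal ?_
          rw [mul_assoc]
          refine mul_le_mul_of_nonneg_left ?_ hC.le
          rw [le_inv_mul_iff₀ hρ0, ← pow_succ']
          exact pow_le_pow_of_le_one hρ0.le hρ1.le hn1
  -- Union bound over all serving transmitters, as ties are not excluded.
  calc p.csp s Qb Qu γ g
      ≤ p.markLaw (⋃ j, {m | p.IsServing s g j ∧ ENNReal.ofReal γ < p.sinr s Qb Qu g m j}) := by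
        refine measure_mono ?_
        rintro m ⟨j, hj⟩
        exact Set.mem_iUnion.2 ⟨j, hj⟩
    _ ≤ ∑' j, p.markLaw {m | p.IsServing s g j ∧ ENNReal.ofReal γ < p.sinr s Qb Qu g m j} :=
        measure_iUnion_le _
    _ ≤ ∑' j, (if p.IsServing s g j then 1 else 0) * ENNReal.ofReal (C * ρ⁻¹ * ρ ^ n) := by
        refine ENNReal.tsum_le_tsum fun j => ?_
        split_ifs with hj
        · rw [one_mul]
          exact (measure_mono fun m hm => hm.2).trans (key j)
        · simp [hj]
    _ = _ := ENNReal.tsum_mul_right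

open Classical in
/-- If a UAV nearby is in line of sight, then all serving transmitters are nearby. -/
lemma exists_tsum_isServing_le (s : Scenario) (R : ℝ) :
    ∃ ρ : ℝ, 1 ≤ ρ ∧ ∀ g, g ∉ p.noLoS R →
      (∑' j, if p.IsServing s g j then 1 else 0) ≤
        pointCount g.1 (disc ρ) + pointCount g.2.1 (disc ρ) := by
  obtain ⟨ρ, hρ1, hρ⟩ := p.exists_forall_servPow_lt s
    (p.servPow_pos s Tier.L (p.link_pos Tier.L R))
  refine ⟨ρ, hρ1, fun g hg => ?_⟩
  have hnorm : ∀ j, p.IsServing s g j → ‖proj g j‖ < ρ := by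
    intro j hj
    by_contra hc
    have h1 := p.servPow_le_of_isServing hj hg
    rw [rxPow_eq] at h1
    exact absurd h1 (not_le.2 (hρ _ _ ((not_lt.1 hc).trans (p.le_link _ _))))
  rw [ENNReal.summable.tsum_sum ENNReal.summable]
  refine add_le_add (ENNReal.tsum_le_tsum fun i => ?_) (ENNReal.tsum_le_tsum fun i => ?_)
  · split_ifs with hj
    · exact (Set.indicator_of_mem (mem_disc.2 (hnorm _ hj)) fun _ => (1 : ℝ≥0∞)).ge
    · exact zero_le
  · split_ifs with hj
    · exact (Set.indicator_of_mem (mem_disc.2 (hnorm _ hj)) fun _ => (1 : ℝ≥0∞)).ge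
    · exact zero_le

end Params

/-! ### Moments of the conditional success probability -/

/-- On `D` the bound 1 is used, off `D` the bound `a`, and μ(D | A) ≤ μ D / μ A. The measurable hull
of `D` makes this valid for arbitrary `A` and `D`. -/
lemma lintegral_cond_le {Ω : Type*} [MeasurableSpace Ω] {μ : Measure Ω} [IsProbabilityMeasure μ]
    {A D : Set Ω} {f : Ω → ℝ≥0∞} {a : ℝ≥0∞} (hA : μ A ≠ 0) (h1 : ∀ x, f x ≤ 1)
    (ha : ∀ x, x ∉ D → f x ≤ a) : ∫⁻ x, f x ∂(μ[|A]) ≤ μ D / μ A + a := by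
  have hm := measurableSet_toMeasurable μ D
  calc ∫⁻ x, f x ∂(μ[|A])
      ≤ ∫⁻ x, (toMeasurable μ D).indicator 1 x + a ∂(μ[|A]) := by
        refine lintegral_mono fun x => ?_
        by_cases hx : x ∈ D
        · rw [Set.indicator_of_mem (subset_toMeasurable μ D hx)]
          exact (h1 x).trans le_self_add
        · exact (ha x hx).trans le_add_self
    _ = (μ[|A]) (toMeasurable μ D) + a * (μ[|A]) Set.univ := by
        rw [lintegral_add_right _ measurable_const, lintegral_indicator_one hm, lintegral_const]
    _ ≤ μ D / μ A + a := by
        have := cond_isProbabilityMeasure hA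
        rw [measure_univ, mul_one]
        refine add_le_add_left ?_ a
        rw [ProbabilityTheory.cond, Measure.smul_apply, Measure.restrict_apply hm, smul_eq_mul,
          mul_comm, ← div_eq_mul_inv, ← measure_toMeasurable D]
        exact ENNReal.div_le_div_right (measure_mono Set.inter_subset_left) _

namespace Params

variable (p : Params)

/-- Geometries in which the success probability may be large: no line-of-sight UAV nearby, few
UAVs in a large disc, or too many transmitters that may serve. -/
def atypical (R R' ρ m lam : ℝ) : Set Geometry :=
  p.noLoS R ∪ {g | pointCount g.2.1 (disc R') ≤ ENNReal.ofReal lam} ∪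
    {g | ENNReal.ofReal (m * lam) ≤ pointCount g.2.1 (disc ρ)} ∪
    {g | ENNReal.ofReal (m * lam) ≤ pointCount g.1 (disc ρ)} ∪
    {g | ¬ ∃ n : ℕ, pointCount g.2.1 (disc R') = n}

lemma csp_le_one (s : Scenario) (Qb Qu : Measure (ℕ → Plane)) (γ : ℝ) (g : Geometry) :
    p.csp s Qb Qu γ g ≤ 1 := prob_le_one

/-- Off the atypical geometries the conditional success probability is exponentially small. -/
lemma exists_csp_le_of_typical (s : Scenario) {γ : ℝ} (hγ : 0 < γ) (R : ℝ) :
    ∃ ρ : ℝ, 1 ≤ ρ ∧ ∀ R' : ℝ, ∃ C z : ℝ, 0 < C ∧ 0 < z ∧ z < 1 ∧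
      ∀ (Qb Qu : Measure (ℕ → Plane)) (m lam : ℝ), 0 ≤ m → 0 ≤ lam →
        ∀ g, g ∉ p.atypical R R' ρ m lam →
        p.csp s Qb Qu γ g ≤ ENNReal.ofReal (2 * m * C * (lam * z ^ lam)) := by
  classical
  obtain ⟨ρ, hρ, hJ⟩ := p.exists_tsum_isServing_le s R
  refine ⟨ρ, hρ, fun R' => ?_⟩
  obtain ⟨C, z, hC, hz0, hz1, hcsp⟩ := p.exists_csp_le s hγ R'
  refine ⟨C, z, hC, hz0, hz1, fun Qb Qu m lam hm hl g hg => ?_⟩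
  simp only [atypical, Set.mem_union, not_or, Set.mem_ofPred_eq, not_le, not_not] at hg
  obtain ⟨⟨⟨⟨h1, h2⟩, h3⟩, h4⟩, n, hn⟩ := hg
  have hln : lam ≤ n := by
    rw [hn] at h2
    have := ENNReal.toReal_mono (by simp) h2.le
    rwa [ENNReal.toReal_ofReal hl, ENNReal.toReal_natCast] at this
  calc p.csp s Qb Qu γ g
      ≤ (ENNReal.ofReal (m * lam) + ENNReal.ofReal (m * lam)) * ENNReal.ofReal (C * z ^ n) :=
        (hcsp Qb Qu g n hn).trans
          (mul_le_mul' ((hJ g h1).trans (add_le_add h4.le h3.le)) le_rfl)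
    _ = ENNReal.ofReal ((m * lam + m * lam) * (C * z ^ n)) := by
        rw [← ENNReal.ofReal_add (by positivity) (by positivity),
          ← ENNReal.ofReal_mul (by positivity)]
    _ ≤ _ := by
        refine ENNReal.ofReal_le_ofReal ?_
        have : z ^ n ≤ z ^ lam := by
          rw [← Real.rpow_natCast]
          exact Real.rpow_le_rpow_of_exponent_ge hz0 hz1.le hln
        calc (m * lam + m * lam) * (C * z ^ n) ≤ (m * lam + m * lam) * (C * z ^ lam) := by gcongr
          _ = _ := by ring

/-- Each UAV event has a Chernoff exponent linear in λ_u, whose rate reaches any K when R, R' and m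
are large. The mean number of TBSs does not grow with λ_u, so it only enters through a constant
factor. -/
lemma measure_atypical_le {q : ℝ} (hq : ∀ (Qb Qu : Measure (ℕ → Plane)) (lam : ℝ),
      IsProbabilityMeasure Qb → 0 ≤ lam → IsPlanarPPP lam Qu → ∀ R, 0 ≤ R →
      netLaw Qb Qu (p.noLoS R) ≤ ENNReal.ofReal (Real.exp (-(q * (lam * (Real.pi * R ^ 2))))))
    {Qb Qu : Measure (ℕ → Plane)} {lamb lam : ℝ} (hlamb : 0 ≤ lamb) (hlam : 1 ≤ lam)
    (hQb : IsPlanarPPP lamb Qb) (hQu : IsPlanarPPP lam Qu) {R R' ρ m K : ℝ} (hR : 0 ≤ R)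
    (hR' : 0 ≤ R') (hρ : 0 ≤ ρ) (h1 : K ≤ q * (Real.pi * R ^ 2)) (h2 : K ≤ Real.pi * R' ^ 2 / 2 - 1)
    (h3 : K ≤ m - 2 * (Real.pi * ρ ^ 2)) :
    netLaw Qb Qu (p.atypical R R' ρ m lam) ≤
      ENNReal.ofReal ((3 + Real.exp (2 * (lamb * (Real.pi * ρ ^ 2)))) * Real.exp (-(K * lam))) := by
  have := hQb.prob
  have := hQu.prob
  have hl : 0 ≤ lam := zero_le_one.trans hlam
  have b1 : netLaw Qb Qu (p.noLoS R) ≤ ENNReal.ofReal (Real.exp (-(K * lam))) := by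
    refine (hq Qb Qu lam inferInstance hl hQu R hR).trans (ENNReal.ofReal_le_ofReal
      (Real.exp_le_exp.2 ?_))
    nlinarith
  have b2 : netLaw Qb Qu {g | pointCount g.2.1 (disc R') ≤ ENNReal.ofReal lam} ≤
      ENNReal.ofReal (Real.exp (-(K * lam))) := by
    have h := hQu.prob_count_le (measurableSet_disc R') (intensity_disc_lt_top lam hR') hl
    rw [intensity_disc hl hR', ← netLaw_uav (Qb := Qb)] at h
    refine h.trans (ENNReal.ofReal_le_ofReal (Real.exp_le_exp.2 ?_))
    nlinarith
  have b3 : netLaw Qb Qu {g | ENNReal.ofReal (m * lam) ≤ pointCount g.2.1 (disc ρ)} ≤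
      ENNReal.ofReal (Real.exp (-(K * lam))) := by
    have h := hQu.prob_le_count (measurableSet_disc ρ) (intensity_disc_lt_top lam hρ) (m * lam)
    rw [intensity_disc hl hρ, ← netLaw_uav (Qb := Qb)] at h
    refine h.trans (ENNReal.ofReal_le_ofReal (Real.exp_le_exp.2 ?_))
    nlinarith
  have b4 : netLaw Qb Qu {g | ENNReal.ofReal (m * lam) ≤ pointCount g.1 (disc ρ)} ≤
      ENNReal.ofReal (Real.exp (2 * (lamb * (Real.pi * ρ ^ 2))) * Real.exp (-(K * lam))) := by
    have h := hQb.prob_le_count (measurableSet_disc ρ) (intensity_disc_lt_top lamb hρ) (m * lam)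
    rw [intensity_disc hlamb hρ, ← netLaw_tbs (Qu := Qu)] at h
    rw [← Real.exp_add]
    refine h.trans (ENNReal.ofReal_le_ofReal (Real.exp_le_exp.2 ?_))
    have : 0 ≤ Real.pi * ρ ^ 2 := by positivity
    nlinarith
  have b5 : netLaw Qb Qu {g | ¬ ∃ n : ℕ, pointCount g.2.1 (disc R') = n} = 0 :=
    (netLaw_uav {x | ¬ ∃ n : ℕ, pointCount x (disc R') = n}).trans
      (hQu.ae_exists_count (measurableSet_disc R') (intensity_disc_lt_top lam hR'))
  calc _ ≤ ENNReal.ofReal (Real.exp (-(K * lam))) + ENNReal.ofReal (Real.exp (-(K * lam))) +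
        ENNReal.ofReal (Real.exp (-(K * lam))) +
        ENNReal.ofReal (Real.exp (2 * (lamb * (Real.pi * ρ ^ 2))) * Real.exp (-(K * lam))) + 0 :=
        (measure_union_le _ _).trans (add_le_add ((measure_union_le _ _).trans (add_le_add
          ((measure_union_le _ _).trans (add_le_add ((measure_union_le _ _).trans
            (add_le_add b1 b2)) b3)) b4)) b5.le)
    _ = _ := by
        rw [add_zero, ← ENNReal.ofReal_add (by positivity) (by positivity),
          ← ENNReal.ofReal_add (by positivity) (by positivity),
          ← ENNReal.ofReal_add (by positivity) (by positivity)]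
        congr 1
        ring

lemma tendsto_mul_rpow_self {z : ℝ} (h0 : 0 < z) (h1 : z < 1) :
    Tendsto (fun lam : ℝ => lam * z ^ lam) atTop (𝓝 0) := by
  have hb : 0 < -Real.log z := neg_pos.2 (Real.log_neg h0 h1)
  have h := Real.tendsto_pow_mul_exp_neg_atTop_nhds_zero 1
  have h2 := (h.comp (tendsto_id.atTop_mul_const hb)).mul_const ((-Real.log z)⁻¹)
  rw [zero_mul] at h2
  refine h2.congr fun lam => ?_
  simp only [Function.comp_apply, id_eq, pow_one]
  rw [Real.rpow_def_of_pos h0, show -(lam * -Real.log z) = Real.log z * lam by ring]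
  have hz : Real.log z ≠ 0 := (Real.log_neg h0 h1).ne
  field_simp

/-- A race of exponents: the atypical event has rate C + 1 and the conditioning event rate at most
C, so their ratio is O(exp(-λ_u)). -/
lemma tendsto_condMoment (s : Scenario) {Qb : Measure (ℕ → Plane)} {lamb : ℝ} (hlamb : 0 < lamb)
    (hQb : IsPlanarPPP lamb Qb) {Qu : ℝ → Measure (ℕ → Plane)}
    (hQu : ∀ lamu : ℝ, 0 < lamu → IsPlanarPPP lamu (Qu lamu)) {γ : ℝ} (hγ : 0 < γ) {n : ℕ}
    (hn : 1 ≤ n) (k : Tier) :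
    Tendsto (fun lamu => p.condMoment s Qb (Qu lamu) γ n k) atTop (𝓝 0) := by
  obtain ⟨c, C, hc, hA⟩ := p.exists_le_assocProb s hlamb hQb k
  obtain ⟨q, hq0, hq⟩ := p.exists_noLoS_le
  have hbig : ∀ a : ℝ, 0 < a → ∃ R : ℝ, 0 ≤ R ∧ C + 2 ≤ a * R ^ 2 := by
    intro a ha
    have ht : Tendsto (fun R : ℝ => a * R ^ 2) atTop atTop :=
      (tendsto_pow_atTop two_ne_zero).const_mul_atTop ha
    obtain ⟨R, h1, h2⟩ := ((eventually_ge_atTop 0).and (ht.eventually_ge_atTop (C + 2))).exists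
    exact ⟨R, h1, h2⟩
  have hpi := Real.pi_pos
  -- The order of choices matters: ρ depends on R, and m below depends on ρ. The margin 2 in `hbig`
  -- covers the rate K = C + 1 and the extra -1 in the condition on R'.
  obtain ⟨R, hR, h1⟩ := hbig (q * Real.pi) (by positivity)
  obtain ⟨R', hR', h2⟩ := hbig (Real.pi / 2) (by positivity)
  obtain ⟨ρ, hρ, h⟩ := p.exists_csp_le_of_typical s hγ R
  obtain ⟨B, z, hB, hz0, hz1, hcsp⟩ := h R'
  have hρ0 : 0 ≤ ρ := zero_le_one.trans hρ
  set m : ℝ := max 0 (C + 1 + 2 * (Real.pi * ρ ^ 2)) with hm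
  set E : ℝ := 3 + Real.exp (2 * (lamb * (Real.pi * ρ ^ 2))) with hE
  have hE0 : 0 < E := by positivity
  have hbound : ∀ᶠ lam in atTop, p.condMoment s Qb (Qu lam) γ n k ≤
      ENNReal.ofReal (E / c * Real.exp (-lam)) +
        ENNReal.ofReal (2 * m * B * (lam * z ^ lam)) := by
    filter_upwards [eventually_ge_atTop 1] with lam hlam
    have hl : 0 < lam := zero_lt_one.trans_le hlam
    have := hQb.prob
    have := (hQu lam hl).prob
    have hAk := hA lam (Qu lam) hl (hQu lam hl)
    rw [min_eq_right hlam, mul_one] at hAk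
    have hcpos : 0 < c * Real.exp (-(C * lam)) := by positivity
    have hAk' : ENNReal.ofReal (c * Real.exp (-(C * lam))) ≤
        netLaw Qb (Qu lam) (p.assocEvent s k) :=
      (ENNReal.ofReal_le_iff_le_toReal (measure_ne_top _ _)).2 hAk
    have hA0 : netLaw Qb (Qu lam) (p.assocEvent s k) ≠ 0 :=
      ((ENNReal.ofReal_pos.2 hcpos).trans_le hAk').ne'
    have hD := p.measure_atypical_le hq hlamb.le hlam hQb (hQu lam hl) (R := R) (R' := R')
      (ρ := ρ) (m := m) (K := C + 1) hR hR' hρ0 (by linarith) (by linarith)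
      (by linarith [le_max_right 0 (C + 1 + 2 * (Real.pi * ρ ^ 2))])
    -- Since the conditional success probability is at most 1 and n ≥ 1, its n-th power is bounded
    -- by the probability itself.
    refine (lintegral_cond_le (D := p.atypical R R' ρ m lam) hA0
      (fun g => pow_le_one₀ zero_le (p.csp_le_one s Qb (Qu lam) γ g))
      (fun g hg => (pow_le_of_le_one zero_le (p.csp_le_one s Qb (Qu lam) γ g)
        (Nat.one_le_iff_ne_zero.1 hn)).trans
        (hcsp Qb (Qu lam) m lam (le_max_left _ _) hl.le g hg))).trans ?_
    refine add_le_add_left ?_ _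
    refine (ENNReal.div_le_div hD hAk').trans ?_
    rw [← ENNReal.ofReal_div_of_pos hcpos]
    refine ENNReal.ofReal_le_ofReal (le_of_eq ?_)
    rw [mul_div_mul_comm, ← Real.exp_sub]
    congr 2
    ring
  have hlim : Tendsto (fun lam : ℝ => ENNReal.ofReal (E / c * Real.exp (-lam)) +
      ENNReal.ofReal (2 * m * B * (lam * z ^ lam))) atTop (𝓝 0) := by
    have t1 := ENNReal.tendsto_ofReal (Real.tendsto_exp_neg_atTop_nhds_zero.const_mul (E / c))
    have t2 := ENNReal.tendsto_ofReal ((tendsto_mul_rpow_self hz0 hz1).const_mul (2 * m * B))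
    simpa using t1.add t2
  exact tendsto_of_tendsto_of_tendsto_of_le_of_le' tendsto_const_nhds hlim
    (Eventually.of_forall fun _ => zero_le) hbound

end Params

end UAVNet

end

theorem corollary4 (p : UAVNet.Params) (s : UAVNet.Scenario)
    (hLN : p.kap UAVNet.Tier.N * p.Hu ^ (-(p.alp UAVNet.Tier.N)) <
      p.kap UAVNet.Tier.L * p.Hu ^ (-(p.alp UAVNet.Tier.L)))
    (lamb : ℝ) (hlamb : 0 < lamb)
    (Qb : Measure (ℕ → UAVNet.Plane)) (hQb : UAVNet.IsPlanarPPP lamb Qb)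
    (Qu : ℝ → Measure (ℕ → UAVNet.Plane))
    (hQu : ∀ lamu : ℝ, 0 < lamu → UAVNet.IsPlanarPPP lamu (Qu lamu)) :
    Tendsto (fun lamu => p.assocProb s Qb (Qu lamu) UAVNet.Tier.b) atTop
      (𝓝 (1 - Real.exp (-(Real.pi * lamb *
        (p.chi s UAVNet.Tier.L UAVNet.Tier.b p.Hu ^ 2 - p.Hb ^ 2))))) ∧
    Tendsto (fun lamu => p.assocProb s Qb (Qu lamu) UAVNet.Tier.L) atTop
      (𝓝 (Real.exp (-(Real.pi * lamb *
        (p.chi s UAVNet.Tier.L UAVNet.Tier.b p.Hu ^ 2 - p.Hb ^ 2))))) ∧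
    Tendsto (fun lamu => p.assocProb s Qb (Qu lamu) UAVNet.Tier.N) atTop (𝓝 0) ∧
    (∀ k : UAVNet.Tier, (∀ lamu : ℝ, 0 < lamu → 0 < p.assocProb s Qb (Qu lamu) k) ∧
      ∀ γ : ℝ, 0 < γ → ∀ n : ℕ, 1 ≤ n →
        Tendsto (fun lamu => p.condMoment s Qb (Qu lamu) γ n k) atTop (𝓝 0)) ∧
    (p.Pb * p.GMb * p.kap UAVNet.Tier.b * p.Hb ^ (-(p.alp UAVNet.Tier.b)) ≤
        p.Pu * p.GMu * p.kap UAVNet.Tier.L * p.Hu ^ (-(p.alp UAVNet.Tier.L)) →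
      Tendsto (fun lamu => p.assocProb s Qb (Qu lamu) UAVNet.Tier.L) atTop (𝓝 1)) := by
  rw [mul_comm Real.pi lamb, mul_assoc lamb, ← p.tbsRadius_sq s]
  refine ⟨p.tendsto_assocProb_b s hLN hlamb hQb hQu, p.tendsto_assocProb_L s hLN hlamb hQb hQu,
    p.tendsto_assocProb_N s hLN hQb hQu, fun k => ⟨fun lamu hl => ?_, fun γ hγ n hn =>
      p.tendsto_condMoment s hlamb hQb hQu hγ hn k⟩, fun h => ?_⟩
  · obtain ⟨c, C, hc, hA⟩ := p.exists_le_assocProb s hlamb hQb k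
    refine lt_of_lt_of_le ?_ (hA lamu (Qu lamu) hl (hQu lamu hl))
    have : 0 < min lamu 1 := lt_min hl one_pos
    positivity
  · have ht := p.tendsto_assocProb_L s hLN hlamb hQb hQu
    simpa [p.tbsRadius_eq_zero s h] using ht
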